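/- **Setting.** Let $d\ge 1$, let $h=n_1,n_2,\dots,n_d$ be positive integers, and let $\sigma_1,\dots,\sigma_{d-1}:\mathbb R\to\mathbb R$ be activation functions such that each $\sigma_i$ is continuous, non-decreasing, $L_i$-Lipschitz with $L_i>0$, satisfies $\sigma_i(0)\ge 0$, and for which there are $q_i,Q_i>0$ with $\sigma_i(x_2)-\sigma_i(x_1)\ge Q_i(x_2-x_1)$ whenever $0\le x_1\le x_2\le q_i$. For matrices $W_i\in\mathbb R^{n_{i+1}\times n_i}$ ($1\le i\le d-1$) and a vector $w_d\in\mathbb R^{n_d}$ consider the depth-$d$ network $$f(x)=w_d^{T}\sigma_{d-1}\bigl(W_{d-1}\sigma_{d-2}(\cdots\sigma_1(W_1x))\bigr),\qquad x\in\mathbb R^{h},$$ with the $\sigma_i$ applied entrywise. For constants $M_F(i)\ge 0$ and $M_{1,\infty}(i)\ge 0$ ($1\le i\le d$) let $\mathcal W_F$ be the set of parameters with $\|W_i\|_F\le M_F(i)$ for $i\le d-1$ and $\|w_d\|_2\le M_F(d)$, and let $\mathcal W_{1,\infty}$ be the set of parameters with $\|W_i\|_{1,\infty}\le M_{1,\infty}(i)$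 for $i\le d-1$ and $\|w_d\|_1\le M_{1,\infty}(d)$; here $\|\cdot\|_F$ is the Frobenius norm and $\|W\|_{1,\infty}$ is the maximal $\ell^1$ norm of the rows of $W$. For the class $\mathcal F$ of all networks with parameters in the chosen set, put $$d_{\mathcal F}(\mu,\nu)=\sup_{f\in\mathcal F}\bigl|\mathbb E_{x\sim\mu}f(x)-\mathbb E_{x\sim\nu}f(x)\bigr| .$$ **Theorem.** Let $\mu,\nu$ be Borel probability measures on $\mathbb R^h$ supported in $\{x:\|x\|_2\le\Gamma_B\}$, let $n,m\ge1$ and $0<\delta\le 1$, and let $\hat\mu_n,\hat\nu_m$ be the empirical distributions of $n$ i.i.d. samples from $\mu$ and of $m$ i.i.d. samples from $\nu$, the two samples being independent of each other. (I) If the parameter set is $\mathcal W_F$ and $\sigma_i(\alpha x)=\alpha\sigma_i(x)$ for all $i$, all $\alpha>0$ and all $x$, then with probability at least $1-\delta$ $$|d_{\mathcal F}(\mu,\nu)-d_{\mathcal F}(\hat\mu_n,\hat\nu_m)|\le\sqrt2\,\Gamma_B\prod_{i=1}^{d}M_F(i)\prod_{i=1}^{d-1}L_i\Bigl(2\sqrt{d\log2}+\sqrt{\log(1/\delta)}+\sqrt2\Bigr)\bigl(n^{-1/2}+m^{-1/2}\bigr).$$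 (II) If the parameter set is $\mathcal W_{1,\infty}$ and $\sigma_i(0)=0$ for all $i$, then with probability at least $1-\delta$ $$|d_{\mathcal F}(\mu,\nu)-d_{\mathcal F}(\hat\mu_n,\hat\nu_m)|\le\Gamma_B\prod_{i=1}^{d}M_{1,\infty}(i)\prod_{i=1}^{d-1}L_i\Bigl(4\sqrt{d+1+\log h}+\sqrt{2\log(1/\delta)}\Bigr)\bigl(n^{-1/2}+m^{-1/2}\bigr).$$ -/

import Mathlib

open MeasureTheory
open scoped NNReal ENNReal

noncomputable section

namespace NeuralNetDistance

/-- Frobenius norm of a real matrix. -/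
def frobNorm {r c : ℕ} (W : Matrix (Fin r) (Fin c) ℝ) : ℝ :=
  Real.sqrt (∑ i, ∑ j, W i j ^ 2)

/-- The norm `‖W‖_{1,∞}`: the maximal `ℓ¹` norm of the rows of `W`
(the value is `0` for a matrix without rows). -/
def oneInftyNorm {r c : ℕ} (W : Matrix (Fin r) (Fin c) ℝ) : ℝ :=
  ⨆ i, ∑ j, |W i j|

/-- Euclidean norm of a parameter vector. -/
def l2Norm {r : ℕ} (w : Fin r → ℝ) : ℝ := Real.sqrt (∑ j, w j ^ 2)

/-- `ℓ¹` norm of a parameter vector. -/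
def l1Norm {r : ℕ} (w : Fin r → ℝ) : ℝ := ∑ j, |w j|

/-- The standing assumptions on an activation function `σ` with Lipschitz constant `L`. -/
structure IsActivation (σ : ℝ → ℝ) (L : ℝ≥0) : Prop where
  continuous : Continuous σ
  monotone : Monotone σ
  zero_nonneg : 0 ≤ σ 0
  lipschitz_pos : 0 < L
  lipschitz : LipschitzWith L σ
  slope : ∃ q Q : ℝ, 0 < q ∧ 0 < Q ∧
    ∀ x₁ x₂ : ℝ, 0 ≤ x₁ → x₁ ≤ x₂ → x₂ ≤ q → Q * (x₂ - x₁) ≤ σ x₂ - σ x₁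

/-- Parameters of a depth-`d` network whose layers have widths `width 0` (the input dimension),
`width 1`, ..., `width (d - 1)`: weight matrices, of which only those with index `i < d - 1` are
used, and an output vector. All layers are indexed from `0`. -/
abbrev Params (d : ℕ) (width : ℕ → ℕ) : Type :=
  ((i : ℕ) → Matrix (Fin (width (i + 1))) (Fin (width i)) ℝ) × (Fin (width (d - 1)) → ℝ)

/-- Output of the first `k` hidden layers: the input for `k = 0`, then `σₖ (Wₖ · )` entrywise. -/
def hidden (width : ℕ → ℕ) (σ : ℕ → ℝ → ℝ)
    (W : (i : ℕ) → Matrix (Fin (width (i + 1))) (Fin (width i)) ℝ)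
    (x : EuclideanSpace ℝ (Fin (width 0))) : (k : ℕ) → Fin (width k) → ℝ
  | 0 => fun j => x j
  | k + 1 => fun j => σ k ((W k).mulVec (hidden width σ W x k) j)

/-- The depth-`d` network: `d - 1` hidden layers followed by a linear output. -/
def network (d : ℕ) (width : ℕ → ℕ) (σ : ℕ → ℝ → ℝ) (p : Params d width)
    (x : EuclideanSpace ℝ (Fin (width 0))) : ℝ :=
  ∑ j, p.2 j * hidden width σ p.1 x (d - 1) j

/-- The parameter set with Frobenius norm constraints. -/
def paramsF (d : ℕ) (width : ℕ → ℕ) (M : ℕ → ℝ) : Set (Params d width) :=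
  {p | (∀ i < d - 1, frobNorm (p.1 i) ≤ M i) ∧ l2Norm p.2 ≤ M (d - 1)}

/-- The parameter set with `‖·‖_{1,∞}` norm constraints. -/
def paramsOneInfty (d : ℕ) (width : ℕ → ℕ) (M : ℕ → ℝ) : Set (Params d width) :=
  {p | (∀ i < d - 1, oneInftyNorm (p.1 i) ≤ M i) ∧ l1Norm p.2 ≤ M (d - 1)}

/-- The class of networks with parameters in a given set. -/
def networkClass (d : ℕ) (width : ℕ → ℕ) (σ : ℕ → ℝ → ℝ) (𝒲 : Set (Params d width)) :
    Set (EuclideanSpace ℝ (Fin (width 0)) → ℝ) :=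
  network d width σ '' 𝒲

/-- The integral probability metric of a function class. -/
def ipm {E : Type*} [MeasurableSpace E] (F : Set (E → ℝ)) (μ ν : Measure E) : ℝ :=
  ⨆ f : F, |∫ x, f.1 x ∂μ - ∫ x, f.1 x ∂ν|

/-- The empirical distribution of a sample. -/
def empirical {E : Type*} [MeasurableSpace E] {n : ℕ} (x : Fin n → E) : Measure E :=
  (n : ℝ≥0∞)⁻¹ • ∑ i, Measure.dirac (x i)

/-- The Borel probability measures on `ℝʰ` that are supported in `{x : ‖x‖ ≤ Γ}`. -/
def boundedClass (h : ℕ) (Γ : ℝ) : Set (Measure (EuclideanSpace ℝ (Fin h))) :=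
  {μ | IsProbabilityMeasure μ ∧ ∀ᵐ x ∂μ, ‖x‖ ≤ Γ}

/-- The joint law of `n` samples from `μ` and `m` samples from `ν`, all independent. -/
def sampleLaw {E : Type*} [MeasurableSpace E] (n m : ℕ) (μ ν : Measure E) :
    Measure ((Fin n → E) × (Fin m → E)) :=
  (Measure.pi fun _ : Fin n => μ).prod (Measure.pi fun _ : Fin m => ν)

end NeuralNetDistance

end

namespace NeuralNetDistance

/-! The error in `ipm` is at most the sum, over the two samples, of the largest deviation of a
sample mean from the true mean over the class (`uniformDeviation`). All networks in the class are
bounded on the ball by `B = Γ ∏ M ∏ L`, so changing one of `n` sample points moves this deviation by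
at most `2B/n`. McDiarmid's inequality makes it sub-Gaussian with parameter `B²/n`, and independence
adds the parameters of the two samples (`sampleLaw_uniformDeviation_ge`). Symmetrization
(`lintegral_iSup_deviation_le`) bounds the mean deviation by twice a Rademacher average.

The Rademacher average is bounded through exponential moments of the supremum. Under either norm
constraint a layer is dominated by a single neuron (`DominatedByNeuron`), and the contraction
principle `sum_signs_iSup_expE_le` then replaces the activation by its Lipschitz constant. Each
layer costs a factor `L * M` in the exponent and, because of an absolute value, a factor 2 in front.
After `d - 1` layers the factor `2 ^ (d - 1)` sits outside the exponential, so it enters only as `(d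
- 1) log 2` under a square root. What remains is a Rademacher sum of the inputs, with moment at most
`exp (a + t² n Γ² / 2)`, and optimizing over `t` gives `B √n √(2 ((d - 1) log 2 + a))`.

Both claims are instances of `PeelableClass.estimation`. The Frobenius case uses the Euclidean norm
and `a = log 2`, the other the sup norm and `a = log 2 + log h`. -/

/-- The sign `±1` encoded by a Boolean. -/
def sgn (b : Bool) : ℝ := bif b then 1 else -1

@[simp] lemma sgn_true : sgn true = 1 := rfl
@[simp] lemma sgn_false : sgn false = -1 := rfl

lemma sgn_not (b : Bool) : sgn (!b) = -sgn b := by cases b <;> simp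

/-- The exponential as an extended nonnegative real number. -/
noncomputable def expE (x : ℝ) : ℝ≥0∞ := ENNReal.ofReal (Real.exp x)

lemma expE_mono {x y : ℝ} (h : x ≤ y) : expE x ≤ expE y :=
  ENNReal.ofReal_le_ofReal (Real.exp_le_exp.2 h)

/-! ### Contraction principle for exponential moments of suprema. -/

lemma exp_increment_le {x y x' y' : ℝ} (h : x ≤ y) (h' : x' - x ≤ y' - y) (h0 : x ≤ x') :
    Real.exp x' - Real.exp x ≤ Real.exp y' - Real.exp y := by
  have e1 : Real.exp x' = Real.exp x * Real.exp (x' - x) := by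
    rw [← Real.exp_add]; ring_nf
  have e2 : Real.exp y' = Real.exp y * Real.exp (y' - y) := by
    rw [← Real.exp_add]; ring_nf
  have h1 : 1 ≤ Real.exp (x' - x) := Real.one_le_exp (by linarith)
  have h2 := Real.exp_le_exp.2 h'
  have h3 := Real.exp_le_exp.2 h
  rw [e1, e2]
  nlinarith [mul_le_mul h3 (sub_le_sub_right h2 1) (by linarith) (Real.exp_pos y).le]

/-- The left side is `2 exp u cosh p`, and `cosh` is increasing in the absolute value. -/
lemma exp_add_exp_sub_le {u p q : ℝ} (h : |p| ≤ |q|) :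
    Real.exp (u + p) + Real.exp (u - p) ≤ Real.exp (u + q) + Real.exp (u - q) := by
  have := Real.cosh_le_cosh.2 h
  rw [Real.cosh_eq, Real.cosh_eq] at this
  rw [Real.exp_add, Real.exp_add, sub_eq_add_neg, sub_eq_add_neg, Real.exp_add, Real.exp_add]
  nlinarith [Real.exp_pos u]

/-- Two-point core of the contraction principle; `A` and `B` stand for suprema over the index. If
moving both terms to the same index does not decrease the sum, monotonicity of `cosh` suffices.
Otherwise, for `q₂ ≥ 0`, the plus sign is given to the larger of `q₁`, `q₂` and convexity of `exp`
compares increments; for `q₂ ≤ 0` the comparison is termwise. -/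
lemma exp_contraction_of_nonneg {u₁ u₂ p₁ p₂ q₁ q₂ A B : ℝ}
    (hp₁ : |p₁| ≤ |q₁|) (hp₂ : |p₂| ≤ |q₂|) (h : |p₁ - p₂| ≤ |q₁ - q₂|) (h₁ : 0 ≤ q₁)
    (hA₁ : Real.exp (u₁ + q₁) ≤ A) (hA₂ : Real.exp (u₂ + q₂) ≤ A)
    (hB₁ : Real.exp (u₁ - q₁) ≤ B) (hB₂ : Real.exp (u₂ - q₂) ≤ B) :
    Real.exp (u₁ + p₁) + Real.exp (u₂ - p₂) ≤ A + B := by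
  have ⟨l1, r1⟩ := abs_le.1 hp₁
  have ⟨l2, r2⟩ := abs_le.1 hp₂
  rw [abs_of_nonneg h₁] at l1 r1
  by_cases c1 : u₁ + p₁ < u₂ + p₂
  · have := exp_add_exp_sub_le (u := u₂) hp₂
    have := Real.exp_le_exp.2 c1.le
    linarith
  by_cases c2 : u₂ - p₂ < u₁ - p₁
  · have := exp_add_exp_sub_le (u := u₁) hp₁
    have := Real.exp_le_exp.2 c2.le
    linarith
  push Not at c1 c2
  rcases le_total 0 q₂ with h₂ | h₂
  · rw [abs_of_nonneg h₂] at l2 r2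
    rcases le_total q₂ q₁ with hq | hq
    · rw [abs_of_nonneg (sub_nonneg.2 hq)] at h
      have ⟨l3, r3⟩ := abs_le.1 h
      linarith [exp_increment_le (x := u₂ - q₂) (x' := u₂ - p₂) (y := u₁ + p₁) (y' := u₁ + q₁)
        (by linarith) (by linarith) (by linarith)]
    · rw [abs_of_nonpos (sub_nonpos.2 hq)] at h
      have ⟨l3, r3⟩ := abs_le.1 h
      linarith [exp_increment_le (x := u₁ - q₁) (x' := u₁ + p₁) (y := u₂ - p₂) (y' := u₂ + q₂)
        (by linarith) (by linarith) (by linarith)]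
  · rw [abs_of_nonpos h₂] at l2 r2
    have := Real.exp_le_exp.2 (by linarith : u₁ + p₁ ≤ u₁ + q₁)
    have := Real.exp_le_exp.2 (by linarith : u₂ - p₂ ≤ u₂ - q₂)
    linarith

lemma exp_contraction {u₁ u₂ p₁ p₂ q₁ q₂ A B : ℝ}
    (hp₁ : |p₁| ≤ |q₁|) (hp₂ : |p₂| ≤ |q₂|) (h : |p₁ - p₂| ≤ |q₁ - q₂|)
    (hA₁ : Real.exp (u₁ + q₁) ≤ A) (hA₂ : Real.exp (u₂ + q₂) ≤ A)
    (hB₁ : Real.exp (u₁ - q₁) ≤ B) (hB₂ : Real.exp (u₂ - q₂) ≤ B) :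
    Real.exp (u₁ + p₁) + Real.exp (u₂ - p₂) ≤ A + B := by
  rcases le_total 0 q₁ with h₁ | h₁
  · exact exp_contraction_of_nonneg hp₁ hp₂ h h₁ hA₁ hA₂ hB₁ hB₂
  · rw [add_comm A]
    refine exp_contraction_of_nonneg (q₁ := -q₁) (q₂ := -q₂) (by rwa [abs_neg]) (by rwa [abs_neg])
      ?_ (by linarith) (by rwa [← sub_eq_add_neg]) (by rwa [← sub_eq_add_neg])
      (by rwa [sub_neg_eq_add]) (by rwa [sub_neg_eq_add])
    rwa [neg_sub_neg, abs_sub_comm q₂]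

/-- Contraction in one sign, with `u` collecting all other terms. Values in `ℝ≥0∞` make boundedness
of the suprema irrelevant. -/
lemma iSup_expE_contraction {ι : Type*} (u p q : ι → ℝ) (hp : ∀ s, |p s| ≤ |q s|)
    (h : ∀ s t, |p s - p t| ≤ |q s - q t|) :
    (⨆ s, expE (u s + p s)) + ⨆ s, expE (u s - p s)
      ≤ (⨆ s, expE (u s + q s)) + ⨆ s, expE (u s - q s) := by
  rcases isEmpty_or_nonempty ι with _ | _
  · simp
  refine ENNReal.iSup_add_iSup_le fun s t => ?_
  have hA (s) := le_iSup (fun s => expE (u s + q s)) s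
  have hB (s) := le_iSup (fun s => expE (u s - q s)) s
  rw [expE, expE, ← ENNReal.ofReal_add (Real.exp_pos _).le (Real.exp_pos _).le]
  refine (ENNReal.ofReal_le_ofReal (exp_contraction (A := max (Real.exp (u s + q s))
    (Real.exp (u t + q t))) (B := max (Real.exp (u s - q s)) (Real.exp (u t - q t)))
    (hp s) (hp t) (h s t) (le_max_left _ _) (le_max_right _ _) (le_max_left _ _)
    (le_max_right _ _))).trans ?_
  rw [ENNReal.ofReal_add (by positivity) (by positivity)]
  gcongr
  · rcases max_choice (Real.exp (u s + q s)) (Real.exp (u t + q t)) with e | e <;> rw [e]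
    exacts [hA s, hA t]
  · rcases max_choice (Real.exp (u s - q s)) (Real.exp (u t - q t)) with e | e <;> rw [e]
    exacts [hB s, hB t]

lemma sum_signs_succ {n : ℕ} {α : Type*} [AddCommMonoid α] (F : (Fin (n + 1) → Bool) → α) :
    ∑ ε, F ε = ∑ ε : Fin n → Bool, (F (Fin.cons true ε) + F (Fin.cons false ε)) := by
  rw [← (Fin.consEquiv fun _ => Bool).sum_comp, Fintype.sum_prod_type_right]
  simp [Fin.consEquiv]

lemma sum_signs_not {n : ℕ} {α : Type*} [AddCommMonoid α] (F : (Fin n → Bool) → α) :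
    ∑ ε : Fin n → Bool, F (fun i => !ε i) = ∑ ε, F ε :=
  (Equiv.arrowCongr (Equiv.refl (Fin n)) Equiv.boolNot).sum_comp F

/-- Comparison of exponential moments of suprema of Rademacher sums. -/
lemma sum_signs_iSup_expE_le {ι : Type*} : ∀ (n : ℕ) (a : ι → ℝ) (p q : ι → Fin n → ℝ)
    (_ : ∀ s i, |p s i| ≤ |q s i|) (_ : ∀ s t i, |p s i - p t i| ≤ |q s i - q t i|),
    ∑ ε : Fin n → Bool, ⨆ s, expE (a s + ∑ i, sgn (ε i) * p s i)
      ≤ ∑ ε : Fin n → Bool, ⨆ s, expE (a s + ∑ i, sgn (ε i) * q s i)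
  | 0, a, p, q, _, _ => by simp
  | n + 1, a, p, q, hp, h => by
    -- The offset `a` absorbs the term of the first sign, so induction replaces the remaining
    -- coordinates; `iSup_expE_contraction` then replaces the first one.
    have step (b : Bool) := sum_signs_iSup_expE_le n (fun s => a s + sgn b * p s 0)
      (fun s i => p s i.succ) (fun s i => q s i.succ) (fun s i => hp s _) (fun s t i => h s t _)
    calc _ = ∑ ε : Fin n → Bool,
          ((⨆ s, expE (a s + sgn true * p s 0 + ∑ i, sgn (ε i) * p s i.succ))
          + ⨆ s, expE (a s + sgn false * p s 0 + ∑ i, sgn (ε i) * p s i.succ)) := by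
            rw [sum_signs_succ]
            simp only [Fin.sum_univ_succ, Fin.cons_zero, Fin.cons_succ, add_assoc]
      _ ≤ ∑ ε : Fin n → Bool,
          ((⨆ s, expE (a s + sgn true * p s 0 + ∑ i, sgn (ε i) * q s i.succ))
          + ⨆ s, expE (a s + sgn false * p s 0 + ∑ i, sgn (ε i) * q s i.succ)) := by
            rw [Finset.sum_add_distrib, Finset.sum_add_distrib]
            exact add_le_add (step true) (step false)
      _ ≤ ∑ ε : Fin n → Bool,
          ((⨆ s, expE (a s + sgn true * q s 0 + ∑ i, sgn (ε i) * q s i.succ))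
          + ⨆ s, expE (a s + sgn false * q s 0 + ∑ i, sgn (ε i) * q s i.succ)) := by
            refine Finset.sum_le_sum fun ε _ => ?_
            have key := iSup_expE_contraction (fun s => a s + ∑ i, sgn (ε i) * q s i.succ)
              (fun s => p s 0) (fun s => q s 0) (fun s => hp s 0) (fun s t => h s t 0)
            simp only [sgn_true, sgn_false, one_mul, neg_one_mul, ← sub_eq_add_neg,
              add_right_comm (a _) _ (∑ i, _), sub_add_eq_add_sub] at key ⊢
            exact key
      _ = _ := by
            rw [sum_signs_succ]
            simp only [Fin.sum_univ_succ, Fin.cons_zero, Fin.cons_succ, add_assoc]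

/-- The factor 2 is the price of the absolute value: `exp |z|` is at most `exp z + exp (-z)`, and
flipping all signs identifies the two sums. It is the source of the `log 2` per layer. -/
lemma sum_signs_iSup_expE_abs_le {ι : Type*} {n : ℕ} (p q : ι → Fin n → ℝ)
    (hp : ∀ s i, |p s i| ≤ |q s i|) (h : ∀ s t i, |p s i - p t i| ≤ |q s i - q t i|) :
    ∑ ε : Fin n → Bool, ⨆ s, expE |∑ i, sgn (ε i) * p s i|
      ≤ 2 * ∑ ε : Fin n → Bool, ⨆ s, expE (∑ i, sgn (ε i) * q s i) := by
  have key := sum_signs_iSup_expE_le n (fun _ => 0) p q hp h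
  simp only [zero_add] at key
  refine le_trans ?_ (mul_le_mul_right key 2)
  rw [two_mul]
  nth_rw 3 [← sum_signs_not]
  rw [← Finset.sum_add_distrib]
  refine Finset.sum_le_sum fun ε _ => iSup_le fun s => ?_
  have e : ∑ i, sgn (!ε i) * p s i = -∑ i, sgn (ε i) * p s i := by
    simp [sgn_not]
  rcases abs_choice (∑ i, sgn (ε i) * p s i) with c | c <;> rw [c]
  · exact (le_iSup (fun s => expE (∑ i, sgn (ε i) * p s i)) s).trans le_self_add
  · rw [← e]
    exact (le_iSup (fun s => expE (∑ i, sgn (!ε i) * p s i)) s).trans le_add_self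

/-! ### Exponential moments of Rademacher sums, for scalars and in inner product spaces. -/

lemma sum_signs_exp_le {n : ℕ} (t : Fin n → ℝ) :
    ∑ ε : Fin n → Bool, Real.exp (∑ i, sgn (ε i) * t i)
      ≤ 2 ^ n * Real.exp ((∑ i, t i ^ 2) / 2) := by
  have e : ∑ ε : Fin n → Bool, Real.exp (∑ i, sgn (ε i) * t i) = ∏ i, (2 * Real.cosh (t i)) := by
    simp only [Real.exp_sum]
    rw [← Fintype.piFinset_univ,
      ← Finset.prod_univ_sum (fun _ => Finset.univ) (fun i b => Real.exp (sgn b * t i))]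
    refine Finset.prod_congr rfl fun i _ => ?_
    simp [Real.cosh_eq]
    ring
  rw [e, Finset.sum_div, Real.exp_sum, Finset.prod_mul_distrib]
  simp only [Finset.prod_const, Finset.card_univ, Fintype.card_fin]
  gcongr with i
  exact Real.cosh_le_exp_half_sq _

lemma sum_signs_exp_abs_le {n : ℕ} (t : Fin n → ℝ) :
    ∑ ε : Fin n → Bool, Real.exp |∑ i, sgn (ε i) * t i|
      ≤ 2 ^ n * (2 * Real.exp ((∑ i, t i ^ 2) / 2)) := by
  have h1 := sum_signs_exp_le t
  have h2 := sum_signs_exp_le (fun i => -t i)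
  simp only [mul_neg, Finset.sum_neg_distrib, neg_sq] at h2
  calc _ ≤ ∑ ε : Fin n → Bool, (Real.exp (∑ i, sgn (ε i) * t i)
        + Real.exp (-∑ i, sgn (ε i) * t i)) := Finset.sum_le_sum fun ε _ => Real.exp_abs_le _
    _ ≤ _ := by rw [Finset.sum_add_distrib]; linarith

/-- Among pairs of nonnegative numbers with given sum, power sums increase with the spread. -/
lemma pow_add_pow_le_of_spread {u v a b : ℝ} (k : ℕ) (hb : 0 ≤ b) (hu : b ≤ u) (hua : u ≤ a)
    (h : u + v = a + b) : u ^ k + v ^ k ≤ a ^ k + b ^ k := by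
  rcases (hu.trans hua).eq_or_lt with hab | hab
  · have : u = b := by linarith
    have : v = b := by linarith
    subst_vars; rfl
  have ha : 0 ≤ a := by linarith
  obtain ⟨t, ht0, ht1, rfl⟩ : ∃ t : ℝ, 0 ≤ t ∧ t ≤ 1 ∧ u = t * a + (1 - t) * b := by
    refine ⟨(u - b) / (a - b), div_nonneg (by linarith) (by linarith),
      (div_le_one (by linarith)).2 (by linarith), ?_⟩
    have : a - b ≠ 0 := by linarith
    field_simp
    ring
  obtain rfl : v = (1 - t) * a + t * b := by linarith
  have c := convexOn_pow (𝕜 := ℝ) k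
  have c1 := c.2 (x := a) ha (y := b) hb ht0 (sub_nonneg.2 ht1) (by ring)
  have c2 := c.2 (x := a) ha (y := b) hb (sub_nonneg.2 ht1) ht0 (by ring)
  simp only [smul_eq_mul] at c1 c2
  linarith

/-- The power series of `cosh` involves only squared norms. The squares of `‖x ± y‖` and of `‖x‖ ±
‖y‖` have the same sum by the parallelogram law, and the former are less spread by Cauchy–Schwarz,
so the series compare term by term. -/
lemma cosh_norm_add_add_cosh_norm_sub_le {E : Type*} [NormedAddCommGroup E]
    [InnerProductSpace ℝ E] (x y : E) :
    Real.cosh ‖x + y‖ + Real.cosh ‖x - y‖ ≤ 2 * (Real.cosh ‖x‖ * Real.cosh ‖y‖) := by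
  have e : 2 * (Real.cosh ‖x‖ * Real.cosh ‖y‖)
      = Real.cosh (‖x‖ + ‖y‖) + Real.cosh (‖x‖ - ‖y‖) := by
    rw [Real.cosh_add, Real.cosh_sub]; ring
  rw [e]
  refine hasSum_le (fun k => ?_) ((Real.hasSum_cosh _).add (Real.hasSum_cosh _))
    ((Real.hasSum_cosh _).add (Real.hasSum_cosh _))
  rw [← add_div, ← add_div, pow_mul, pow_mul, pow_mul, pow_mul]
  gcongr ?_ / _
  have h1 := norm_add_sq_real x y
  have h2 := norm_sub_sq_real x y
  have ⟨i1, i2⟩ := abs_le.1 (abs_real_inner_le_norm x y)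
  exact pow_add_pow_le_of_spread k (sq_nonneg _) (by nlinarith) (by nlinarith) (by nlinarith)

lemma sum_signs_cosh_norm_le {E : Type*} [NormedAddCommGroup E] [InnerProductSpace ℝ E] :
    ∀ (n : ℕ) (s : E) (x : Fin n → E),
    ∑ ε : Fin n → Bool, Real.cosh ‖s + ∑ i, sgn (ε i) • x i‖
      ≤ 2 ^ n * (Real.cosh ‖s‖ * ∏ i, Real.cosh ‖x i‖)
  | 0, s, x => by simp
  | n + 1, s, x => by
    have h1 := sum_signs_cosh_norm_le n (s + x 0) (fun i => x i.succ)
    have h2 := sum_signs_cosh_norm_le n (s - x 0) (fun i => x i.succ)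
    have h3 := cosh_norm_add_add_cosh_norm_sub_le s (x 0)
    have hP : 0 ≤ 2 ^ n * ∏ i : Fin n, Real.cosh ‖x i.succ‖ :=
      mul_nonneg (by positivity) (Finset.prod_nonneg fun i _ => (Real.cosh_pos _).le)
    rw [sum_signs_succ, Finset.sum_add_distrib]
    simp only [Fin.sum_univ_succ, Fin.prod_univ_succ, Fin.cons_zero, Fin.cons_succ, sgn_true,
      sgn_false, one_smul, neg_smul, ← add_assoc, ← sub_eq_add_neg]
    calc _ ≤ _ := add_le_add h1 h2
      _ = (2 ^ n * ∏ i : Fin n, Real.cosh ‖x i.succ‖)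
          * (Real.cosh ‖s + x 0‖ + Real.cosh ‖s - x 0‖) := by ring
      _ ≤ (2 ^ n * ∏ i : Fin n, Real.cosh ‖x i.succ‖)
          * (2 * (Real.cosh ‖s‖ * Real.cosh ‖x 0‖)) := mul_le_mul_of_nonneg_left h3 hP
      _ = _ := by ring

/-- The bound is dimension-free; the factor 2 comes from `exp r ≤ 2 cosh r`. -/
lemma sum_signs_exp_norm_le {E : Type*} [NormedAddCommGroup E] [InnerProductSpace ℝ E]
    {n : ℕ} (x : Fin n → E) :
    ∑ ε : Fin n → Bool, Real.exp ‖∑ i, sgn (ε i) • x i‖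
      ≤ 2 ^ n * (2 * Real.exp ((∑ i, ‖x i‖ ^ 2) / 2)) := by
  have h := sum_signs_cosh_norm_le n 0 x
  simp only [zero_add, norm_zero, Real.cosh_zero, one_mul] at h
  have h' : ∏ i, Real.cosh ‖x i‖ ≤ Real.exp ((∑ i, ‖x i‖ ^ 2) / 2) := by
    rw [Finset.sum_div, Real.exp_sum]
    exact Finset.prod_le_prod (fun i _ => (Real.cosh_pos _).le)
      fun i _ => Real.cosh_le_exp_half_sq _
  calc _ ≤ ∑ ε : Fin n → Bool, 2 * Real.cosh ‖∑ i, sgn (ε i) • x i‖ := by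
        refine Finset.sum_le_sum fun ε _ => ?_
        rw [Real.cosh_eq]
        linarith [Real.exp_pos (-‖∑ i, sgn (ε i) • x i‖)]
    _ ≤ 2 * (2 ^ n * Real.exp ((∑ i, ‖x i‖ ^ 2) / 2)) := by
        rw [← Finset.mul_sum]
        gcongr
        exact h.trans (by gcongr)
    _ = _ := by ring

/-- Passing from exponential moments to the mean of a supremum. -/
lemma sum_signs_iSup_le_of_expE {ι : Type*} {n : ℕ} (z : ι → (Fin n → Bool) → ℝ) {c C : ℝ}
    (hc : 0 < c) (hC : 0 ≤ C)
    (h : ∑ ε, ⨆ s, expE (c * |z s ε|) ≤ 2 ^ n * expE C) :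
    ∑ ε, ⨆ s, ENNReal.ofReal |z s ε| ≤ 2 ^ n * ENNReal.ofReal (C / c) := by
  rcases isEmpty_or_nonempty ι with _ | _
  · simp
  have hE0 : expE C ≠ 0 := (ENNReal.ofReal_pos.2 (Real.exp_pos C)).ne'
  have hEt : expE C ≠ ⊤ := ENNReal.ofReal_ne_top
  have hc0 : ENNReal.ofReal c ≠ 0 := (ENNReal.ofReal_pos.2 hc).ne'
  -- This is `y + 1 ≤ C + exp (y - C)`, the tangent-line form of Jensen's inequality. Summed over
  -- the signs, the last term contributes at most `2 ^ n`, which cancels the `+ 1`.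
  have pt (ε) : ENNReal.ofReal c * (⨆ s, ENNReal.ofReal |z s ε|) + 1
      ≤ ENNReal.ofReal C + (⨆ s, expE (c * |z s ε|)) / expE C := by
    rw [ENNReal.mul_iSup, ENNReal.iSup_add]
    refine iSup_le fun s => ?_
    refine le_trans ?_ (add_le_add_right (ENNReal.div_le_div_right
      (le_iSup (fun s => expE (c * |z s ε|)) s) _) _)
    rw [expE, expE, ← ENNReal.ofReal_div_of_pos (Real.exp_pos _), ← Real.exp_sub,
      ← ENNReal.ofReal_mul hc.le, ← ENNReal.ofReal_one,
      ← ENNReal.ofReal_add (by positivity) zero_le_one,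
      ← ENNReal.ofReal_add hC (Real.exp_pos _).le]
    exact ENNReal.ofReal_le_ofReal (by linarith [Real.add_one_le_exp (c * |z s ε| - C)])
  have hsum := Finset.sum_le_sum fun ε (_ : ε ∈ Finset.univ) => pt ε
  rw [Finset.sum_add_distrib, Finset.sum_add_distrib, ← Finset.mul_sum] at hsum
  simp only [Finset.sum_const, Finset.card_univ, Fintype.card_fun, Fintype.card_bool,
    Fintype.card_fin, nsmul_eq_mul, Nat.cast_pow, Nat.cast_ofNat, mul_one, div_eq_mul_inv] at hsum
  rw [← Finset.sum_mul] at hsum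
  have h2 : (∑ ε, ⨆ s, expE (c * |z s ε|)) * (expE C)⁻¹ ≤ 2 ^ n := by
    rw [← div_eq_mul_inv]
    exact ENNReal.div_le_of_le_mul h
  have h3 := (ENNReal.add_le_add_iff_right (by simp)).1 (hsum.trans (add_le_add_right h2 _))
  rw [ENNReal.ofReal_div_of_pos hc, ← mul_div_assoc, ENNReal.le_div_iff_mul_le (Or.inl hc0)
    (Or.inl ENNReal.ofReal_ne_top), mul_comm]
  exact h3

/-! ### Peeling off the layers of a network. -/

/-- With respect to the size functional `N`, a layer with weight matrices in `𝒜` and activation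
`σ` is dominated by a single neuron, whose weights act with norm at most `M`. -/
def DominatedByNeuron (N : (w : ℕ) → (Fin w → ℝ) → ℝ) (σ : ℝ → ℝ) (M : ℝ) {r c : ℕ}
    (𝒜 : Set (Matrix (Fin r) (Fin c) ℝ)) : Prop :=
  ∃ κ : ℝ, 0 ≤ κ ∧ ∀ W ∈ 𝒜, ∀ (n : ℕ) (v : Fin n → Fin c → ℝ) (e : Fin n → ℝ),
    ∃ w : Fin c → ℝ, (∀ u, κ * |w ⬝ᵥ u| ≤ M * N c u) ∧
      N r (∑ i, e i • fun j => σ (W.mulVec (v i) j)) ≤ κ * |∑ i, e i * σ (w ⬝ᵥ v i)|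

variable {N : (w : ℕ) → (Fin w → ℝ) → ℝ}

lemma abs_sub_le_of_lipschitz {σ : ℝ → ℝ} {L : ℝ≥0} (hσ : LipschitzWith L σ) (x y : ℝ) :
    |σ x - σ y| ≤ L * |x - y| := by
  simpa [Real.dist_eq] using hσ.dist_le_mul x y

lemma abs_le_of_lipschitz {σ : ℝ → ℝ} {L : ℝ≥0} (hσ : LipschitzWith L σ) (h0 : σ 0 = 0)
    (x : ℝ) : |σ x| ≤ L * |x| := by
  simpa [h0] using abs_sub_le_of_lipschitz hσ x 0

/-- A layer at most doubles the exponential moments, up to the norm bounds. -/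
lemma DominatedByNeuron.sum_signs_le {σ : ℝ → ℝ} {L : ℝ≥0} {M : ℝ} {r c : ℕ}
    {𝒜 : Set (Matrix (Fin r) (Fin c) ℝ)} (h : DominatedByNeuron N σ M 𝒜)
    (hσ : LipschitzWith L σ) (h0 : σ 0 = 0) {t : ℝ} (ht : 0 ≤ t) {ι : Type*} {n : ℕ}
    (v : ι → Fin n → Fin c → ℝ) :
    ∑ ε : Fin n → Bool, ⨆ s : 𝒜 × ι,
        expE (t * N r (∑ i, sgn (ε i) • fun j => σ (s.1.1.mulVec (v s.2 i) j)))
      ≤ 2 * ∑ ε : Fin n → Bool, ⨆ s, expE (t * (L * M) * N c (∑ i, sgn (ε i) • v s i)) := by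
  obtain ⟨κ, hκ, h⟩ := h
  -- The dominating neuron may depend on the signs, so the supremum is enlarged to all admissible
  -- neurons before contraction is applied.
  let D := {w : Fin c → ℝ // ∀ u, κ * |w ⬝ᵥ u| ≤ M * N c u}
  let p : D × ι → Fin n → ℝ := fun s i => t * κ * σ (s.1.1 ⬝ᵥ v s.2 i)
  let q : D × ι → Fin n → ℝ := fun s i => t * κ * (L * (s.1.1 ⬝ᵥ v s.2 i))
  have htκ : 0 ≤ t * κ := mul_nonneg ht hκ
  have hpq := sum_signs_iSup_expE_abs_le p q
    (fun s i => by
      simp only [p, q, abs_mul, abs_of_nonneg ht, abs_of_nonneg hκ, NNReal.abs_eq]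
      exact mul_le_mul_of_nonneg_left (abs_le_of_lipschitz hσ h0 _) htκ)
    (fun s s' i => by
      simp only [p, q, ← mul_sub, abs_mul, abs_of_nonneg ht, abs_of_nonneg hκ, NNReal.abs_eq]
      exact mul_le_mul_of_nonneg_left (abs_sub_le_of_lipschitz hσ _ _) htκ)
  refine le_trans (Finset.sum_le_sum fun ε _ => iSup_le fun s => ?_)
    (hpq.trans (mul_le_mul_right (Finset.sum_le_sum fun ε _ => iSup_le fun s => ?_) 2))
  · obtain ⟨w, hw, hle⟩ := h s.1.1 s.1.2 n (v s.2) (fun i => sgn (ε i))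
    refine le_trans (expE_mono ?_)
      (le_iSup (fun s => expE |∑ i, sgn (ε i) * p s i|) ((⟨w, hw⟩, s.2) : D × ι))
    refine (mul_le_mul_of_nonneg_left hle ht).trans_eq ?_
    have : ∑ i, sgn (ε i) * p (⟨w, hw⟩, s.2) i = t * κ * ∑ i, sgn (ε i) * σ (w ⬝ᵥ v s.2 i) := by
      rw [Finset.mul_sum]
      exact Finset.sum_congr rfl fun i _ => by simp only [p]; ring
    rw [this, abs_mul, abs_of_nonneg htκ, mul_assoc]
  · refine le_trans (expE_mono ?_) (le_iSup (fun s => expE (t * (L * M) * N c (∑ i,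
      sgn (ε i) • v s i))) s.2)
    have e : ∑ i, sgn (ε i) * q s i = t * L * (κ * (s.1.1 ⬝ᵥ ∑ i, sgn (ε i) • v s.2 i)) := by
      rw [dotProduct_sum, Finset.mul_sum, Finset.mul_sum]
      exact Finset.sum_congr rfl fun i _ => by simp only [q, dotProduct_smul, smul_eq_mul]; ring
    have h1 := s.1.2 (∑ i, sgn (ε i) • v s.2 i)
    have h2 : κ * (s.1.1 ⬝ᵥ ∑ i, sgn (ε i) • v s.2 i) ≤ M * N c (∑ i, sgn (ε i) • v s.2 i) :=
      (mul_le_mul_of_nonneg_left (le_abs_self _) hκ).trans h1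
    rw [e]
    calc _ ≤ t * L * (M * N c (∑ i, sgn (ε i) • v s.2 i)) :=
          mul_le_mul_of_nonneg_left h2 (by positivity)
      _ = _ := by ring

/-- Domination for a single sample point with coefficient 1. -/
lemma DominatedByNeuron.apply_le {σ : ℝ → ℝ} {L : ℝ≥0} {M : ℝ} {r c : ℕ}
    {𝒜 : Set (Matrix (Fin r) (Fin c) ℝ)} (h : DominatedByNeuron N σ M 𝒜)
    (hσ : LipschitzWith L σ) (h0 : σ 0 = 0) {W : Matrix (Fin r) (Fin c) ℝ} (hW : W ∈ 𝒜)
    (v : Fin c → ℝ) : N r (fun j => σ (W.mulVec v j)) ≤ L * M * N c v := by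
  obtain ⟨κ, hκ, h⟩ := h
  obtain ⟨w, hw, hle⟩ := h W hW 1 (fun _ => v) (fun _ => 1)
  simp only [Finset.univ_unique, Finset.sum_singleton, one_smul, one_mul] at hle
  calc _ ≤ κ * |σ (w ⬝ᵥ v)| := hle
    _ ≤ κ * (L * |w ⬝ᵥ v|) := mul_le_mul_of_nonneg_left (abs_le_of_lipschitz hσ h0 _) hκ
    _ = L * (κ * |w ⬝ᵥ v|) := by ring
    _ ≤ L * (M * N c v) := mul_le_mul_of_nonneg_left (hw v) L.2
    _ = _ := by ring

/-- Norm constraints on the layers of a network for which layers can be peeled off. -/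
structure PeelableClass (d : ℕ) (width : ℕ → ℕ) (σ : ℕ → ℝ → ℝ) (L : ℕ → ℝ≥0) (M : ℕ → ℝ)
    (Γ a : ℝ) (N : (w : ℕ) → (Fin w → ℝ) → ℝ)
    (𝒜 : (i : ℕ) → Set (Matrix (Fin (width (i + 1))) (Fin (width i)) ℝ))
    (𝒪 : Set (Fin (width (d - 1)) → ℝ)) : Prop where
  layer : ∀ i < d - 1, DominatedByNeuron N (σ i) (M i) (𝒜 i)
  lipschitz : ∀ i < d - 1, LipschitzWith (L i) (σ i)
  map_zero : ∀ i < d - 1, σ i 0 = 0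
  bound_nonneg : ∀ i < d, 0 ≤ M i
  output : ∀ w ∈ 𝒪, ∀ u, |∑ j, w j * u j| ≤ M (d - 1) * N _ u
  input : ∀ x : EuclideanSpace ℝ (Fin (width 0)), ‖x‖ ≤ Γ → N _ (fun j => x j) ≤ Γ
  moment : ∀ t : ℝ, 0 ≤ t → ∀ (n : ℕ) (x : Fin n → EuclideanSpace ℝ (Fin (width 0))),
    (∀ i, ‖x i‖ ≤ Γ) →
    ∑ ε : Fin n → Bool, expE (t * N _ (∑ i, sgn (ε i) • fun j => x i j))
      ≤ 2 ^ n * expE (a + t ^ 2 * (n * Γ ^ 2) / 2)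

/-- The parameters that satisfy given constraints layer by layer. -/
def constrainedParams (d : ℕ) (width : ℕ → ℕ)
    (𝒜 : (i : ℕ) → Set (Matrix (Fin (width (i + 1))) (Fin (width i)) ℝ))
    (𝒪 : Set (Fin (width (d - 1)) → ℝ)) : Set (Params d width) :=
  {p | (∀ i < d - 1, p.1 i ∈ 𝒜 i) ∧ p.2 ∈ 𝒪}

namespace PeelableClass

variable {d : ℕ} {width : ℕ → ℕ} {σ : ℕ → ℝ → ℝ} {L : ℕ → ℝ≥0} {M : ℕ → ℝ} {Γ a : ℝ}
  {𝒜 : (i : ℕ) → Set (Matrix (Fin (width (i + 1))) (Fin (width i)) ℝ)}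
  {𝒪 : Set (Fin (width (d - 1)) → ℝ)}

lemma hidden_le (h : PeelableClass d width σ L M Γ a N 𝒜 𝒪)
    {W : (i : ℕ) → Matrix (Fin (width (i + 1))) (Fin (width i)) ℝ}
    {x : EuclideanSpace ℝ (Fin (width 0))} (hx : ‖x‖ ≤ Γ) (k : ℕ) (hk : k ≤ d - 1)
    (hW : ∀ i < k, W i ∈ 𝒜 i) :
    N _ (hidden width σ W x k) ≤ (∏ i ∈ Finset.range k, (L i * M i)) * Γ := by
  induction k with
  | zero =>
    rw [Finset.range_zero, Finset.prod_empty, one_mul]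
    exact h.input x hx
  | succ k ih =>
    have hk' : k < d - 1 := hk
    have h1 := (h.layer k hk').apply_le (h.lipschitz k hk') (h.map_zero k hk')
      (hW k (Nat.lt_succ_self k)) (hidden width σ W x k)
    have h2 := ih hk'.le fun i hi => hW i (hi.trans (Nat.lt_succ_self k))
    have hM := h.bound_nonneg k (by omega)
    rw [Finset.prod_range_succ]
    calc _ ≤ L k * M k * N _ (hidden width σ W x k) := h1
      _ ≤ L k * M k * ((∏ i ∈ Finset.range k, (L i * M i)) * Γ) :=
          mul_le_mul_of_nonneg_left h2 (by positivity)
      _ = _ := by ring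

lemma bound_mul_prod_eq (hd : 1 ≤ d) (M : ℕ → ℝ) (L : ℕ → ℝ≥0) :
    M (d - 1) * ∏ i ∈ Finset.range (d - 1), (L i * M i)
      = (∏ i ∈ Finset.range d, M i) * ∏ i ∈ Finset.range (d - 1), (L i : ℝ) := by
  obtain ⟨k, rfl⟩ : ∃ k, d = k + 1 := ⟨d - 1, by omega⟩
  rw [Finset.prod_mul_distrib, Finset.prod_range_succ, Nat.add_sub_cancel]
  ring

lemma abs_network_le (h : PeelableClass d width σ L M Γ a N 𝒜 𝒪) (hd : 1 ≤ d)
    {p : Params d width} (hp : p ∈ constrainedParams d width 𝒜 𝒪)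
    {x : EuclideanSpace ℝ (Fin (width 0))} (hx : ‖x‖ ≤ Γ) :
    |network d width σ p x|
      ≤ Γ * (∏ i ∈ Finset.range d, M i) * ∏ i ∈ Finset.range (d - 1), (L i : ℝ) := by
  calc _ ≤ M (d - 1) * N _ (hidden width σ p.1 x (d - 1)) := h.output _ hp.2 _
    _ ≤ M (d - 1) * ((∏ i ∈ Finset.range (d - 1), (L i * M i)) * Γ) :=
        mul_le_mul_of_nonneg_left (h.hidden_le hx _ le_rfl hp.1) (h.bound_nonneg _ (by omega))
    _ = _ := by rw [mul_assoc Γ, ← bound_mul_prod_eq hd]; ring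

lemma sum_signs_hidden_le (h : PeelableClass d width σ L M Γ a N 𝒜 𝒪) {n : ℕ}
    (x : Fin n → EuclideanSpace ℝ (Fin (width 0))) (k : ℕ) (hk : k ≤ d - 1) {t : ℝ}
    (ht : 0 ≤ t) :
    ∑ ε : Fin n → Bool, ⨆ W : {W : (i : ℕ) → Matrix (Fin (width (i + 1))) (Fin (width i)) ℝ //
        ∀ i < k, W i ∈ 𝒜 i}, expE (t * N _ (∑ i, sgn (ε i) • hidden width σ W.1 (x i) k))
      ≤ 2 ^ k * ∑ ε : Fin n → Bool, expE (t * (∏ i ∈ Finset.range k, (L i * M i))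
          * N _ (∑ i, sgn (ε i) • fun j => x i j)) := by
  induction k generalizing t with
  | zero =>
    simp only [pow_zero, one_mul, Finset.range_zero, Finset.prod_empty, mul_one]
    exact Finset.sum_le_sum fun ε _ => iSup_le fun W => le_rfl
  | succ k ih =>
    have hk' : k < d - 1 := hk
    have hM := h.bound_nonneg k (by omega)
    have h1 := (h.layer k hk').sum_signs_le (h.lipschitz k hk') (h.map_zero k hk') ht
      (fun (W : {W : (i : ℕ) → Matrix (Fin (width (i + 1))) (Fin (width i)) ℝ //
        ∀ i < k, W i ∈ 𝒜 i}) (i : Fin n) => hidden width σ W.1 (x i) k)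
    -- The norm and Lipschitz bounds of the peeled layer are absorbed into `t`, which is why the
    -- induction keeps `t` general.
    have h2 := ih hk'.le (t := t * (L k * M k)) (by positivity)
    calc _ ≤ _ := Finset.sum_le_sum fun ε _ => iSup_le fun W =>
          le_iSup (fun s : 𝒜 k × {W : (i : ℕ) → Matrix (Fin (width (i + 1))) (Fin (width i)) ℝ //
            ∀ i < k, W i ∈ 𝒜 i} => expE (t * N _ (∑ i, sgn (ε i) • fun j =>
              σ k (s.1.1.mulVec (hidden width σ s.2.1 (x i) k) j))))
            (⟨W.1 k, W.2 k (Nat.lt_succ_self k)⟩,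
              ⟨W.1, fun i hi => W.2 i (hi.trans (Nat.lt_succ_self k))⟩)
      _ ≤ _ := h1
      _ ≤ _ := mul_le_mul_right h2 2
      _ = _ := by
        rw [← mul_assoc, ← pow_succ', Finset.prod_range_succ]
        congr 1
        refine Finset.sum_congr rfl fun ε _ => ?_
        congr 2
        ring

/-- Rademacher complexity of a class of networks. -/
lemma sum_signs_network_le (h : PeelableClass d width σ L M Γ a N 𝒜 𝒪) (hd : 1 ≤ d)
    (ha : 0 < a)
    {n : ℕ} (hn : 1 ≤ n) (x : Fin n → EuclideanSpace ℝ (Fin (width 0))) (hx : ∀ i, ‖x i‖ ≤ Γ)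
    {B : ℝ} (hB : B = Γ * (∏ i ∈ Finset.range d, M i) * ∏ i ∈ Finset.range (d - 1), (L i : ℝ))
    (hB0 : 0 < B) :
    ∑ ε : Fin n → Bool, ⨆ p : constrainedParams d width 𝒜 𝒪,
        ENNReal.ofReal |∑ i, sgn (ε i) * network d width σ p.1 (x i)|
      ≤ 2 ^ n * ENNReal.ofReal (B * √n * √(2 * ((d - 1 : ℕ) * Real.log 2 + a))) := by
  set T : ℝ := (d - 1 : ℕ) * Real.log 2 + a with hT
  have hT0 : 0 < T := by positivity
  have hn0 : (0 : ℝ) < n := by exact_mod_cast hn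
  -- The minimizer of `(T + t² n B² / 2) / t`: both summands equal `T`, and the value is `2T / t`.
  set t : ℝ := √(2 * T) / (B * √n) with ht
  have ht0 : 0 < t := by positivity
  have hM : 0 ≤ M (d - 1) := h.bound_nonneg _ (by omega)
  have htB : t ^ 2 * (n * B ^ 2) / 2 = T := by
    rw [ht, div_pow, mul_pow, Real.sq_sqrt (by positivity), Real.sq_sqrt hn0.le]
    field_simp
  have hC : (2 * T) / t = B * √n * √(2 * T) := by
    rw [div_eq_iff ht0.ne', ht]
    field_simp
    rw [Real.sq_sqrt (by positivity)]
  rw [← hC]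
  refine sum_signs_iSup_le_of_expE _ ht0 (by positivity) ?_
  set P := ∏ i ∈ Finset.range (d - 1), (L i * M i) with hP
  have hP0 : 0 ≤ P := Finset.prod_nonneg fun i hi => by
    have := h.bound_nonneg i (by have := Finset.mem_range.1 hi; omega)
    positivity
  have hBP : B = Γ * (M (d - 1) * P) := by rw [hB, hP, bound_mul_prod_eq hd]; ring
  calc _ ≤ ∑ ε : Fin n → Bool,
        ⨆ W : {W : (i : ℕ) → Matrix (Fin (width (i + 1))) (Fin (width i)) ℝ //
          ∀ i < d - 1, W i ∈ 𝒜 i},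
        expE (t * M (d - 1) * N _ (∑ i, sgn (ε i) • hidden width σ W.1 (x i) (d - 1))) := by
        refine Finset.sum_le_sum fun ε _ => iSup_le fun p => ?_
        refine le_trans (expE_mono ?_) (le_iSup (fun W :
          {W : (i : ℕ) → Matrix (Fin (width (i + 1))) (Fin (width i)) ℝ //
            ∀ i < d - 1, W i ∈ 𝒜 i} => expE (t * M (d - 1) *
            N _ (∑ i, sgn (ε i) • hidden width σ W.1 (x i) (d - 1)))) ⟨p.1.1, p.2.1⟩)
        rw [mul_assoc]
        refine mul_le_mul_of_nonneg_left ?_ ht0.le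
        refine le_of_eq_of_le (congrArg abs ?_) (h.output p.1.2 p.2.2
          (∑ i, sgn (ε i) • hidden width σ p.1.1 (x i) (d - 1)))
        simp only [network, Finset.sum_apply, Pi.smul_apply, smul_eq_mul, Finset.mul_sum]
        rw [Finset.sum_comm]
        exact Finset.sum_congr rfl fun j _ => Finset.sum_congr rfl fun i _ => by ring
    _ ≤ _ := h.sum_signs_hidden_le x (d - 1) le_rfl (by positivity)
    _ ≤ 2 ^ (d - 1) * (2 ^ n * expE (a + (t * M (d - 1) * P) ^ 2 * (n * Γ ^ 2) / 2)) :=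
        mul_le_mul_right (h.moment _ (by positivity) n x hx) _
    _ = _ := by
        have e1 : a + (t * M (d - 1) * P) ^ 2 * (n * Γ ^ 2) / 2 = a + T := by
          rw [← htB, hBP]; ring
        have e2 : (2 : ℝ≥0∞) ^ (d - 1) = expE ((d - 1 : ℕ) * Real.log 2) := by
          rw [expE, Real.exp_nat_mul, Real.exp_log two_pos, ENNReal.ofReal_pow two_pos.le]
          norm_num
        have e3 : expE (2 * T) = expE ((d - 1 : ℕ) * Real.log 2) * expE (a + T) := by
          rw [expE, expE, expE, ← ENNReal.ofReal_mul (Real.exp_pos _).le, ← Real.exp_add]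
          congr 2
          rw [hT]; ring
        rw [e1, e2, e3]
        ring

end PeelableClass

/-! ### McDiarmid's inequality through moment generating functions. -/

open ProbabilityTheory

lemma integrable_of_abs_le {X : Type*} [MeasurableSpace X] {μ : Measure X} [IsFiniteMeasure μ]
    {f : X → ℝ} (hf : Measurable f) {C : ℝ} (hC : ∀ x, |f x| ≤ C) : Integrable f μ :=
  Integrable.of_bound hf.aestronglyMeasurable C (.of_forall fun x => by simpa using hC x)

lemma integrable_exp_of_abs_le {X : Type*} [MeasurableSpace X] {μ : Measure X}
    [IsFiniteMeasure μ] {f : X → ℝ} (hf : Measurable f) {C : ℝ} (hC : ∀ x, |f x| ≤ C) :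
    Integrable (fun x => Real.exp (f x)) μ :=
  integrable_of_abs_le (Real.measurable_exp.comp hf) (C := Real.exp C) fun x => by
    rw [abs_of_pos (Real.exp_pos _)]
    exact Real.exp_le_exp.2 ((le_abs_self _).trans (hC x))

lemma abs_integral_le_of_abs_le {X : Type*} [MeasurableSpace X] {μ : Measure X}
    [IsProbabilityMeasure μ] {f : X → ℝ} {C : ℝ} (hC : ∀ x, |f x| ≤ C) : |∫ x, f x ∂μ| ≤ C := by
  simpa using norm_integral_le_of_norm_le_const (μ := μ) (f := f) (C := C)
    (.of_forall fun x => by simpa using hC x)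

/-- Sub-Gaussian bounds on a product: conditionally on the first coordinate, and for the
conditional mean. -/
lemma hasSubgaussianMGF_prod {X Y : Type*} [MeasurableSpace X] [MeasurableSpace Y]
    {μ : Measure X} {ν : Measure Y} [IsProbabilityMeasure μ] [IsProbabilityMeasure ν]
    {f : X × Y → ℝ} (hf : Measurable f) {C : ℝ} (hC : ∀ z, |f z| ≤ C) {c₁ c₂ : ℝ≥0}
    (h₂ : ∀ x, HasSubgaussianMGF (fun y => f (x, y) - ∫ y, f (x, y) ∂ν) c₂ ν)
    (h₁ : HasSubgaussianMGF (fun x => ∫ y, f (x, y) ∂ν - ∫ x, ∫ y, f (x, y) ∂ν ∂μ) c₁ μ) :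
    HasSubgaussianMGF (fun z => f z - ∫ z, f z ∂μ.prod ν) (c₁ + c₂) (μ.prod ν) := by
  have hint : Integrable f (μ.prod ν) := integrable_of_abs_le hf hC
  have hI : |∫ z, f z ∂μ.prod ν| ≤ C := abs_integral_le_of_abs_le hC
  have hexp (t : ℝ) : Integrable (fun z => Real.exp (t * (f z - ∫ z, f z ∂μ.prod ν)))
      (μ.prod ν) :=
    integrable_exp_of_abs_le ((hf.sub_const _).const_mul t) (C := |t| * (C + C)) fun z => by
      rw [abs_mul]
      exact mul_le_mul_of_nonneg_left ((abs_sub _ _).trans (add_le_add (hC z) hI)) (abs_nonneg t)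
  refine ⟨hexp, fun t => ?_⟩
  rw [mgf, integral_prod _ (hexp t), integral_prod _ hint]
  set I := ∫ x, ∫ y, f (x, y) ∂ν ∂μ with hIdef
  -- The deviation splits into the deviation from the conditional mean, bounded uniformly in `x`,
  -- and that of the conditional mean itself.
  have hfac (x : X) : ∫ y, Real.exp (t * (f (x, y) - I)) ∂ν
      ≤ Real.exp (c₂ * t ^ 2 / 2) * Real.exp (t * (∫ y, f (x, y) ∂ν - I)) := by
    have e (y : Y) : Real.exp (t * (f (x, y) - I))
        = Real.exp (t * (f (x, y) - ∫ y, f (x, y) ∂ν)) * Real.exp (t * (∫ y, f (x, y) ∂ν - I)) := by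
      rw [← Real.exp_add]; ring_nf
    simp only [e, integral_mul_const]
    exact mul_le_mul_of_nonneg_right ((h₂ x).mgf_le t) (Real.exp_pos _).le
  calc _ ≤ ∫ x, Real.exp (c₂ * t ^ 2 / 2) * Real.exp (t * (∫ y, f (x, y) ∂ν - I)) ∂μ := by
        refine integral_mono ?_ ((h₁.integrable_exp_mul t).const_mul _) hfac
        have := (hexp t).integral_prod_left
        rwa [integral_prod _ hint] at this
    _ = Real.exp (c₂ * t ^ 2 / 2) * ∫ x, Real.exp (t * (∫ y, f (x, y) ∂ν - I)) ∂μ :=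
        integral_const_mul _ _
    _ ≤ Real.exp (c₂ * t ^ 2 / 2) * Real.exp (c₁ * t ^ 2 / 2) :=
        mul_le_mul_of_nonneg_left (h₁.mgf_le t) (Real.exp_pos _).le
    _ = _ := by
        rw [← Real.exp_add]
        push_cast
        ring_nf

/-- A bounded function whose oscillation is at most `c` is sub-Gaussian. -/
lemma hasSubgaussianMGF_of_oscillation {X : Type*} [MeasurableSpace X] {μ : Measure X}
    [IsProbabilityMeasure μ] {f : X → ℝ} (hf : Measurable f) {c : ℝ≥0}
    (hc : ∀ x y, |f x - f y| ≤ c) :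
    HasSubgaussianMGF (fun x => f x - ∫ x, f x ∂μ) ((c / 2) ^ 2) μ := by
  obtain ⟨x₀⟩ : Nonempty X := nonempty_of_isProbabilityMeasure μ
  have : Nonempty X := ⟨x₀⟩
  have hb : BddBelow (Set.range f) := ⟨f x₀ - c, by
    rintro _ ⟨x, rfl⟩
    linarith [(abs_le.1 (hc x₀ x)).2]⟩
  -- Hoeffding's lemma on the interval of length `c` that starts at the infimum of `f`.
  have h := hasSubgaussianMGF_of_mem_Icc (μ := μ) (a := ⨅ x, f x) (b := (⨅ x, f x) + c)
    hf.aemeasurable (.of_forall fun x => ⟨ciInf_le hb x, by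
      have : f x - c ≤ ⨅ x, f x := le_ciInf fun y => by linarith [(abs_le.1 (hc x y)).2]
      linarith⟩)
  simpa using h

/-- **McDiarmid's inequality**, at the level of moment generating functions. -/
theorem hasSubgaussianMGF_pi_of_bounded_differences {E : Type*} [MeasurableSpace E]
    (μ : Measure E) [IsProbabilityMeasure μ] {C : ℝ} {c : ℝ≥0} :
    ∀ (n : ℕ) (f : (Fin n → E) → ℝ) (_ : Measurable f) (_ : ∀ x, |f x| ≤ C)
      (_ : ∀ x i y, |f (Function.update x i y) - f x| ≤ c),
    HasSubgaussianMGF (fun x => f x - ∫ x, f x ∂Measure.pi fun _ : Fin n => μ)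
      (n * (c / 2) ^ 2) (Measure.pi fun _ : Fin n => μ)
  | 0, f, _, _, _ => by
    have e (x : Fin 0 → E) : f x = f default := congrArg f (Subsingleton.elim _ _)
    simp only [e, integral_const, probReal_univ, one_smul, sub_self, Nat.cast_zero, zero_mul]
    exact HasSubgaussianMGF.fun_zero
  | n + 1, f, hf, hC, hc => by
    let e := MeasurableEquiv.piFinSuccAbove (fun _ : Fin (n + 1) => E) 0
    have hmp : MeasurePreserving e (Measure.pi fun _ => μ) (μ.prod (Measure.pi fun _ => μ)) :=
      measurePreserving_piFinSuccAbove (fun _ => μ) 0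
    let g : E × (Fin n → E) → ℝ := fun z => f (e.symm z)
    have hge (z) : g z = f (Fin.cons z.1 z.2) := by
      simp only [g, e, MeasurableEquiv.piFinSuccAbove]
      exact congrArg f (Fin.insertNth_zero' _ _)
    have hgm : Measurable g := hf.comp e.symm.measurable
    have hgi (x : E) : Measurable fun y => g (x, y) := hgm.comp measurable_prodMk_left
    have h₂ (x : E) := hasSubgaussianMGF_pi_of_bounded_differences μ n (fun y => g (x, y))
      (hgi x) (fun y => hC _) (fun y i a => by
        simp only [hge, Fin.cons_update]
        exact hc _ _ _)
    -- Averaging over the other coordinates leaves a function of the first one that still oscillates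
    -- by at most `c`.
    have h₁ := hasSubgaussianMGF_of_oscillation (μ := μ) (c := c)
      (f := fun x => ∫ y, g (x, y) ∂Measure.pi fun _ => μ)
      hgm.stronglyMeasurable.integral_prod_right.measurable (fun a b => by
        rw [← integral_sub (integrable_of_abs_le (hgi a) fun y => hC _)
          (integrable_of_abs_le (hgi b) fun y => hC _)]
        refine abs_integral_le_of_abs_le fun y => ?_
        have := hc (Fin.cons b y) 0 a
        rwa [Fin.update_cons_zero, ← hge (a, y), ← hge (b, y)] at this)
    have h := hasSubgaussianMGF_prod hgm (fun z => hC _) h₂ h₁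
    rw [← hmp.map_eq] at h
    have h' := h.of_map e.measurable.aemeasurable
    rw [e.measurableEmbedding.integral_map] at h'
    have hgf (x) : g (e x) = f x := congrArg f (e.symm_apply_apply x)
    simp only [hgf, Function.comp_def] at h'
    convert h' using 1
    push_cast
    ring

/-! ### Symmetrization and concentration of uniform deviations. -/

section Deviation

variable {E ι : Type*} [MeasurableSpace E] {g : ι → E → ℝ} {B : ℝ} {n : ℕ}

/-- The largest deviation of a sample mean from the mean, over a family of functions. -/
noncomputable def uniformDeviation (g : ι → E → ℝ) (μ : Measure E) {n : ℕ} (x : Fin n → E) : ℝ :=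
  ⨆ i, |∫ y, g i y ∂μ - (∑ k, g i (x k)) / n|

lemma abs_sum_div_le {a : Fin n → ℝ} (hn : 1 ≤ n) (ha : ∀ k, |a k| ≤ B) :
    |(∑ k, a k) / n| ≤ B := by
  have hn0 : (0 : ℝ) < n := by exact_mod_cast hn
  rw [abs_div, Nat.abs_cast, div_le_iff₀ hn0]
  calc _ ≤ ∑ k, |a k| := Finset.abs_sum_le_sum_abs _ _
    _ ≤ ∑ _k : Fin n, B := Finset.sum_le_sum fun k _ => ha k
    _ = _ := by simp [mul_comm]

lemma abs_deviation_le (hgB : ∀ i x, |g i x| ≤ B) (μ : Measure E) [IsProbabilityMeasure μ]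
    (hn : 1 ≤ n) (x : Fin n → E) (i : ι) :
    |∫ y, g i y ∂μ - (∑ k, g i (x k)) / n| ≤ 2 * B := by
  have h1 := abs_integral_le_of_abs_le (μ := μ) (hgB i)
  have h2 := abs_sum_div_le hn fun k => hgB i (x k)
  linarith [abs_sub (∫ y, g i y ∂μ) ((∑ k, g i (x k)) / n)]

lemma bddAbove_deviation (hgB : ∀ i x, |g i x| ≤ B) (μ : Measure E) [IsProbabilityMeasure μ]
    (hn : 1 ≤ n) (x : Fin n → E) :
    BddAbove (Set.range fun i => |∫ y, g i y ∂μ - (∑ k, g i (x k)) / n|) :=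
  ⟨2 * B, by rintro _ ⟨i, rfl⟩; exact abs_deviation_le hgB μ hn x i⟩

lemma le_uniformDeviation (hgB : ∀ i x, |g i x| ≤ B) (μ : Measure E) [IsProbabilityMeasure μ]
    (hn : 1 ≤ n) (x : Fin n → E) (i : ι) :
    |∫ y, g i y ∂μ - (∑ k, g i (x k)) / n| ≤ uniformDeviation g μ x :=
  le_ciSup (bddAbove_deviation hgB μ hn x) i

lemma uniformDeviation_nonneg (g : ι → E → ℝ) (μ : Measure E) (x : Fin n → E) :
    0 ≤ uniformDeviation g μ x :=
  Real.iSup_nonneg fun _ => abs_nonneg _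

lemma measurable_uniformDeviation [Countable ι] (hg : ∀ i, Measurable (g i)) (μ : Measure E) :
    Measurable (uniformDeviation g μ : (Fin n → E) → ℝ) := by
  refine Measurable.iSup fun i => Measurable.abs (measurable_const.sub (Measurable.div_const ?_ _))
  exact Finset.measurable_sum _ fun k _ => (hg i).comp (measurable_pi_apply k)

lemma abs_uniformDeviation_le (hB : 0 ≤ B) (hgB : ∀ i x, |g i x| ≤ B) (μ : Measure E)
    [IsProbabilityMeasure μ] (hn : 1 ≤ n) (x : Fin n → E) : |uniformDeviation g μ x| ≤ 2 * B := by
  rw [abs_of_nonneg (uniformDeviation_nonneg g μ x)]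
  exact Real.iSup_le (abs_deviation_le hgB μ hn x) (by positivity)

lemma uniformDeviation_update_le (hB : 0 ≤ B) (hgB : ∀ i x, |g i x| ≤ B) (μ : Measure E)
    [IsProbabilityMeasure μ] (hn : 1 ≤ n) (x : Fin n → E) (k : Fin n) (y : E) :
    |uniformDeviation g μ (Function.update x k y) - uniformDeviation g μ x| ≤ 2 * B / n := by
  have hn0 : (0 : ℝ) < n := by exact_mod_cast hn
  have hsum (i) : |(∑ j, g i (Function.update x k y j)) / n - (∑ j, g i (x j)) / n|
      ≤ 2 * B / n := by
    rw [← sub_div, abs_div, Nat.abs_cast, ← Finset.sum_sub_distrib,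
      Finset.sum_eq_single k (fun j _ hj => by simp [Function.update_of_ne hj]) (by simp),
      Function.update_self]
    gcongr
    linarith [abs_sub (g i y) (g i (x k)), hgB i y, hgB i (x k)]
  have hpos : 0 ≤ 2 * B / n := by positivity
  rw [abs_sub_le_iff]
  constructor
  · refine sub_le_iff_le_add.2 (Real.iSup_le (fun i => ?_)
      (add_nonneg hpos (uniformDeviation_nonneg g μ x)))
    have h1 := le_uniformDeviation hgB μ hn x i
    have h2 := hsum i
    rw [abs_le] at h1 h2 ⊢
    constructor <;> linarith
  · refine sub_le_iff_le_add.2 (Real.iSup_le (fun i => ?_)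
      (add_nonneg hpos (uniformDeviation_nonneg g μ _)))
    have h1 := le_uniformDeviation hgB μ hn (Function.update x k y) i
    have h2 := hsum i
    rw [abs_le] at h1 h2 ⊢
    constructor <;> linarith

/-- McDiarmid with differences `2B/n`: the parameter is `n * (B/n)² = B²/n`. -/
lemma hasSubgaussianMGF_uniformDeviation [Countable ι] (hg : ∀ i, Measurable (g i))
    (hB : 0 ≤ B) (hgB : ∀ i x, |g i x| ≤ B) (μ : Measure E) [IsProbabilityMeasure μ]
    (hn : 1 ≤ n) :
    HasSubgaussianMGF (fun x => uniformDeviation g μ x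
      - ∫ x, uniformDeviation g μ x ∂Measure.pi fun _ : Fin n => μ)
      (B ^ 2 / n).toNNReal (Measure.pi fun _ : Fin n => μ) := by
  have hn0 : (0 : ℝ) < n := by exact_mod_cast hn
  have hc : 0 ≤ 2 * B / n := by positivity
  convert hasSubgaussianMGF_pi_of_bounded_differences μ (c := (2 * B / n).toNNReal) n
    (uniformDeviation g μ) (measurable_uniformDeviation hg μ)
    (abs_uniformDeviation_le hB hgB μ hn) (fun x k y => by
      rw [Real.coe_toNNReal _ hc]
      exact uniformDeviation_update_le hB hgB μ hn x k y) using 1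
  apply NNReal.coe_injective
  push_cast
  rw [Real.coe_toNNReal _ hc, Real.coe_toNNReal _ (by positivity)]
  field_simp

/-- Symmetrization: the mean of the largest deviation is at most twice the Rademacher mean. -/
lemma lintegral_iSup_deviation_le [Countable ι] (hg : ∀ i, Measurable (g i))
    (hgB : ∀ i x, |g i x| ≤ B) (μ : Measure E) [IsProbabilityMeasure μ] {R : ℝ≥0∞}
    (hR : ∀ x : Fin n → E,
      ∑ ε : Fin n → Bool, ⨆ i, ENNReal.ofReal |∑ k, sgn (ε k) * g i (x k)| ≤ 2 ^ n * R) :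
    ∫⁻ x, ⨆ i, ENNReal.ofReal |n * ∫ y, g i y ∂μ - ∑ k, g i (x k)|
      ∂(Measure.pi fun _ : Fin n => μ) ≤ 2 * R := by
  let P : Measure (Fin n → E) := Measure.pi fun _ => μ
  let S : (Fin n → Bool) → (Fin n → E) → ℝ≥0∞ := fun ε x =>
    ⨆ i, ENNReal.ofReal |∑ k, sgn (ε k) * g i (x k)|
  let D : (Fin n → Bool) → (Fin n → E × E) → ℝ≥0∞ := fun ε z =>
    ⨆ i, ENNReal.ofReal |∑ k, sgn (ε k) * (g i (z k).2 - g i (z k).1)|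
  have hgk (i : ι) (k : Fin n) : Measurable fun x : Fin n → E => g i (x k) :=
    (hg i).comp (measurable_pi_apply k)
  have hfst (k : Fin n) : Measurable fun z : Fin n → E × E => (z k).1 :=
    measurable_fst.comp (measurable_pi_apply k)
  have hsnd (k : Fin n) : Measurable fun z : Fin n → E × E => (z k).2 :=
    measurable_snd.comp (measurable_pi_apply k)
  have hD (ε) : Measurable (D ε) := Measurable.iSup fun i => ENNReal.measurable_ofReal.comp
    (Measurable.abs (Finset.measurable_sum _ fun k _ =>
      (((hg i).comp (hsnd k)).sub ((hg i).comp (hfst k))).const_mul _))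
  let Q : Measure (Fin n → E × E) := Measure.pi fun _ => μ.prod μ
  -- a ghost sample
  have hghost : ∫⁻ x, ⨆ i, ENNReal.ofReal |n * ∫ y, g i y ∂μ - ∑ k, g i (x k)| ∂P
      ≤ ∫⁻ z, D (fun _ => true) z ∂Q := by
    let G : (Fin n → E) × (Fin n → E) → ℝ≥0∞ := fun w =>
      ⨆ i, ENNReal.ofReal |∑ k, (g i (w.2 k) - g i (w.1 k))|
    have hG : Measurable G := Measurable.iSup fun i => ENNReal.measurable_ofReal.comp
      (Measurable.abs (Finset.measurable_sum _ fun k _ =>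
        ((hgk i k).comp measurable_snd).sub ((hgk i k).comp measurable_fst)))
    have hmp := measurePreserving_arrowProdEquivProdArrow E E (Fin n) (fun _ => μ) (fun _ => μ)
    calc _ ≤ ∫⁻ x, ∫⁻ y, G (x, y) ∂P ∂P := by
          refine lintegral_mono fun x => iSup_le fun i => ?_
          have hi (k : Fin n) : Integrable (fun y : Fin n → E => g i (y k)) P :=
            integrable_of_abs_le (hgk i k) fun y => hgB i _
          have e : n * ∫ y, g i y ∂μ - ∑ k, g i (x k)
              = ∫ y, ∑ k, (g i (y k) - g i (x k)) ∂P := by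
            rw [integral_finsetSum Finset.univ
              (f := fun (k : Fin n) (y : Fin n → E) => g i (y k) - g i (x k)) fun k _ => (hi k).sub (integrable_const _)]
            have hk (k : Fin n) : ∫ y, (g i (y k) - g i (x k)) ∂P
                = ∫ y, g i y ∂μ - g i (x k) := by
              rw [integral_sub (hi k) (integrable_const _), integral_const, probReal_univ,
                one_smul]
              congr 1
              exact integral_comp_eval (μ := fun _ : Fin n => μ) (hg i).aestronglyMeasurable
            simp [hk]
          rw [e, ← Real.norm_eq_abs, ofReal_norm]
          refine (enorm_integral_le_lintegral_enorm _).trans (lintegral_mono fun y => ?_)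
          rw [← ofReal_norm, Real.norm_eq_abs]
          exact le_iSup (fun i => ENNReal.ofReal |∑ k, (g i (y k) - g i (x k))|) i
      _ = ∫⁻ w, G w ∂(P.prod P) := (lintegral_prod _ hG.aemeasurable).symm
      _ = ∫⁻ z, G (MeasurableEquiv.arrowProdEquivProdArrow E E (Fin n) z) ∂Q :=
          (hmp.lintegral_comp hG).symm
      _ = _ := by
          simp [G, D, MeasurableEquiv.arrowProdEquivProdArrow, Equiv.arrowProdEquivProdArrow]
  -- exchanging the two samples where `ε` is negative
  have hswap (ε : Fin n → Bool) : ∫⁻ z, D (fun _ => true) z ∂Q = ∫⁻ z, D ε z ∂Q := by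
    let f : Fin n → E × E → E × E := fun k => bif ε k then id else Prod.swap
    have hf (k) : MeasurePreserving (f k) (μ.prod μ) (μ.prod μ) := by
      cases h : ε k
      · simpa only [f, h] using! Measure.measurePreserving_swap
      · simpa only [f, h] using! MeasurePreserving.id _
    have hmp : MeasurePreserving (fun z k => f k (z k)) Q Q :=
      measurePreserving_pi (fun _ => μ.prod μ) (fun _ => μ.prod μ) hf
    rw [← hmp.lintegral_comp (hD _)]
    refine lintegral_congr fun z => ?_
    simp only [D]
    refine iSup_congr fun i => ?_
    congr 2
    refine Finset.sum_congr rfl fun k _ => ?_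
    cases h : ε k <;> simp [f, h]
  have hsplit (ε : Fin n → Bool) (z : Fin n → E × E) :
      D ε z ≤ S ε (fun k => (z k).2) + S ε (fun k => (z k).1) := by
    refine iSup_le fun i => ?_
    refine le_trans ?_ (add_le_add
      (le_iSup (fun i => ENNReal.ofReal |∑ k, sgn (ε k) * g i (z k).2|) i)
      (le_iSup (fun i => ENNReal.ofReal |∑ k, sgn (ε k) * g i (z k).1|) i))
    rw [← ENNReal.ofReal_add (abs_nonneg _) (abs_nonneg _)]
    refine ENNReal.ofReal_le_ofReal ?_
    simp only [mul_sub, Finset.sum_sub_distrib]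
    exact abs_sub _ _
  refine hghost.trans ?_
  -- All sign patterns give the same integral, so it may be averaged over them; both halves of the
  -- split sample contribute `R`.
  have hmean : 2 ^ n * ∫⁻ z, D (fun _ => true) z ∂Q ≤ 2 ^ n * (2 * R) := by
    calc _ = ∑ ε : Fin n → Bool, ∫⁻ z, D ε z ∂Q := by simp [← hswap]
      _ = ∫⁻ z, ∑ ε : Fin n → Bool, D ε z ∂Q := (lintegral_finsetSum _ fun ε _ => hD ε).symm
      _ ≤ ∫⁻ _z, 2 ^ n * R + 2 ^ n * R ∂Q := by
          refine lintegral_mono fun z => ?_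
          refine (Finset.sum_le_sum fun ε _ => hsplit ε z).trans ?_
          rw [Finset.sum_add_distrib]
          exact add_le_add (hR _) (hR _)
      _ = _ := by
          rw [lintegral_const, measure_univ]
          ring
  exact (ENNReal.mul_le_mul_iff_right (by simp) (by simp)).1 hmean

lemma integral_uniformDeviation_le [Countable ι] (hg : ∀ i, Measurable (g i)) (hB : 0 ≤ B)
    (hgB : ∀ i x, |g i x| ≤ B) (μ : Measure E) [IsProbabilityMeasure μ]
    (hn : 1 ≤ n) {R : ℝ} (hR0 : 0 ≤ R)
    (hR : ∀ x : Fin n → E, ∑ ε : Fin n → Bool,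
      ⨆ i, ENNReal.ofReal |∑ k, sgn (ε k) * g i (x k)| ≤ 2 ^ n * ENNReal.ofReal R) :
    ∫ x, uniformDeviation g μ x ∂(Measure.pi fun _ : Fin n => μ) ≤ 2 * R / n := by
  have hn0 : (0 : ℝ) < n := by exact_mod_cast hn
  have key := lintegral_iSup_deviation_le hg hgB μ hR
  have hle (x : Fin n → E) : ENNReal.ofReal (n * uniformDeviation g μ x)
      ≤ ⨆ i, ENNReal.ofReal |n * ∫ y, g i y ∂μ - ∑ k, g i (x k)| := by
    rcases eq_or_ne (⨆ i, ENNReal.ofReal |n * ∫ y, g i y ∂μ - ∑ k, g i (x k)|) ⊤ with h | h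
    · simp [h]
    refine ENNReal.ofReal_le_of_le_toReal ?_
    rw [mul_comm, ← le_div_iff₀ hn0]
    refine Real.iSup_le (fun i => ?_) (by positivity)
    rw [le_div_iff₀ hn0, ← ENNReal.ofReal_le_iff_le_toReal h]
    refine le_of_eq_of_le (congrArg _ ?_)
      (le_iSup (fun i => ENNReal.ofReal |n * ∫ y, g i y ∂μ - ∑ k, g i (x k)|) i)
    nth_rw 2 [← abs_of_pos hn0]
    rw [← abs_mul]
    congr 1
    field_simp
  have h2 := (lintegral_mono hle).trans key
  rw [← ofReal_integral_eq_lintegral_ofReal] at h2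
  · rw [integral_const_mul, ← ENNReal.ofReal_ofNat, ← ENNReal.ofReal_mul two_pos.le,
      ENNReal.ofReal_le_ofReal_iff (by positivity)] at h2
    rwa [le_div_iff₀ hn0, mul_comm]
  · exact (integrable_of_abs_le (measurable_uniformDeviation hg μ)
      (abs_uniformDeviation_le hB hgB μ hn)).const_mul _
  · exact .of_forall fun x => mul_nonneg hn0.le (uniformDeviation_nonneg g μ x)

/-- Two-sample concentration of uniform deviations. -/
theorem sampleLaw_uniformDeviation_ge [Countable ι] (hg : ∀ i, Measurable (g i))
    (hB : 0 < B) (hgB : ∀ i x, |g i x| ≤ B) (μ ν : Measure E) [IsProbabilityMeasure μ]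
    [IsProbabilityMeasure ν] {m : ℕ} (hn : 1 ≤ n) (hm : 1 ≤ m) {Rn Rm : ℝ} (hRn0 : 0 ≤ Rn)
    (hRm0 : 0 ≤ Rm)
    (hRn : ∀ x : Fin n → E, ∑ ε : Fin n → Bool,
      ⨆ i, ENNReal.ofReal |∑ k, sgn (ε k) * g i (x k)| ≤ 2 ^ n * ENNReal.ofReal Rn)
    (hRm : ∀ x : Fin m → E, ∑ ε : Fin m → Bool,
      ⨆ i, ENNReal.ofReal |∑ k, sgn (ε k) * g i (x k)| ≤ 2 ^ m * ENNReal.ofReal Rm)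
    {δ : ℝ} (hδ : 0 < δ) (hδ1 : δ ≤ 1) :
    ENNReal.ofReal (1 - δ) ≤ sampleLaw n m μ ν
      {s | uniformDeviation g μ s.1 + uniformDeviation g ν s.2
        ≤ 2 * Rn / n + 2 * Rm / m + √(2 * (B ^ 2 / n + B ^ 2 / m) * Real.log (1 / δ))} := by
  have hn0 : (0 : ℝ) < n := by exact_mod_cast hn
  have hm0 : (0 : ℝ) < m := by exact_mod_cast hm
  set V := B ^ 2 / n + B ^ 2 / m with hV
  have hV0 : 0 < V := by positivity
  set η := √(2 * V * Real.log (1 / δ)) with hη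
  have hlog : 0 ≤ Real.log (1 / δ) := Real.log_nonneg (by rwa [one_le_div hδ])
  have hm1 : Measurable (uniformDeviation g μ : (Fin n → E) → ℝ) :=
    measurable_uniformDeviation hg μ
  have hm2 : Measurable (uniformDeviation g ν : (Fin m → E) → ℝ) :=
    measurable_uniformDeviation hg ν
  have s1 := hasSubgaussianMGF_uniformDeviation hg hB.le hgB μ hn
  have s2 := hasSubgaussianMGF_uniformDeviation hg hB.le hgB ν hm
  have e1 := integral_uniformDeviation_le hg hB.le hgB μ hn hRn0 hRn
  have e2 := integral_uniformDeviation_le hg hB.le hgB ν hm hRm0 hRm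
  set I₁ := ∫ x, uniformDeviation g μ x ∂(Measure.pi fun _ : Fin n => μ)
  set I₂ := ∫ x, uniformDeviation g ν x ∂(Measure.pi fun _ : Fin m => ν)
  have : IsProbabilityMeasure (sampleLaw n m μ ν) := by unfold sampleLaw; infer_instance
  have p1 : MeasurePreserving Prod.fst (sampleLaw n m μ ν) (Measure.pi fun _ : Fin n => μ) :=
    measurePreserving_fst
  have p2 : MeasurePreserving Prod.snd (sampleLaw n m μ ν) (Measure.pi fun _ : Fin m => ν) :=
    measurePreserving_snd
  rw [← p1.map_eq] at s1
  rw [← p2.map_eq] at s2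
  have s := (s1.of_map p1.measurable.aemeasurable).add_of_indepFun
    (s2.of_map p2.measurable.aemeasurable)
    (indepFun_prod (μ := Measure.pi fun _ : Fin n => μ) (ν := Measure.pi fun _ : Fin m => ν)
      (hm1.sub_const _) (hm2.sub_const _))
  have tail := s.measure_ge_le (ε := η) (Real.sqrt_nonneg _)
  -- The value of `η` makes the sub-Gaussian tail exactly `δ`.
  have hexp : Real.exp
      (-η ^ 2 / (2 * ((B ^ 2 / n).toNNReal + (B ^ 2 / m).toNNReal : ℝ≥0))) = δ := by
    rw [NNReal.coe_add, Real.coe_toNNReal _ (by positivity), Real.coe_toNNReal _ (by positivity),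
      ← hV, hη, Real.sq_sqrt (by positivity), one_div, Real.log_inv]
    rw [show -(2 * V * -Real.log δ) / (2 * V) = Real.log δ by field_simp, Real.exp_log hδ]
  rw [hexp] at tail
  set A : Set ((Fin n → E) × (Fin m → E)) := {s | uniformDeviation g μ s.1
    + uniformDeviation g ν s.2 ≤ 2 * Rn / n + 2 * Rm / m + η} with hA
  have hAm : MeasurableSet A := measurableSet_le
    ((hm1.comp measurable_fst).add (hm2.comp measurable_snd)) measurable_const
  have hAc : (sampleLaw n m μ ν).real Aᶜ ≤ δ := by
    refine le_trans (measureReal_mono fun s hs => ?_) tail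
    simp only [hA, Set.mem_compl_iff, Set.mem_ofPred_eq, not_le] at hs
    simp only [Set.mem_ofPred_eq, Function.comp_apply]
    linarith
  rw [probReal_compl_eq_one_sub hAm] at hAc
  refine ENNReal.ofReal_le_of_le_toReal ?_
  change 1 - δ ≤ (sampleLaw n m μ ν).real A
  linarith

end Deviation

/-! ### Reduction to a countable bounded family, and the general estimate. -/

/-- Continuous functions on a compact metric space form a separable metric space, so every subset of
it is separable. A countable family makes the supremum of deviations measurable, and staying inside
`F` preserves the Rademacher bound. -/
lemma exists_countable_uniformly_dense {X : Type*} [MetricSpace X] {K : Set X}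
    (hK : IsCompact K) {F : Set (X → ℝ)} (hF : ∀ f ∈ F, Continuous f) :
    ∃ F₀ ⊆ F, F₀.Countable ∧ ∀ f ∈ F, ∀ η > 0, ∃ g ∈ F₀, ∀ x ∈ K, |f x - g x| ≤ η := by
  have : CompactSpace K := isCompact_iff_compactSpace.1 hK
  let r : F → C(K, ℝ) := fun f => ⟨fun x => f.1 x, (hF f.1 f.2).comp continuous_subtype_val⟩
  obtain ⟨t, htc, htd⟩ := TopologicalSpace.exists_countable_dense (Set.range r)
  choose φ hφ using fun y : Set.range r => y.2
  refine ⟨(fun y => (φ y).1) '' t, ?_, htc.image _, fun f hf η hη => ?_⟩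
  · rintro _ ⟨y, -, rfl⟩
    exact (φ y).2
  · obtain ⟨y, hy, hd⟩ := htd.exists_dist_lt ⟨r ⟨f, hf⟩, Set.mem_range_self _⟩ hη
    refine ⟨_, ⟨y, hy, rfl⟩, fun x hx => ?_⟩
    rw [Subtype.dist_eq, ← hφ y] at hd
    have := (ContinuousMap.dist_apply_le_dist (f := r ⟨f, hf⟩) (g := r (φ y)) ⟨x, hx⟩).trans hd.le
    rwa [Real.dist_eq] at this

lemma integral_empirical {E : Type*} [MeasurableSpace E] {n : ℕ} (x : Fin n → E) {f : E → ℝ}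
    (hf : Measurable f) : ∫ y, f y ∂empirical x = (∑ k, f (x k)) / n := by
  rw [empirical, integral_smul_measure, integral_finsetSum_measure fun k _ =>
    (integrable_dirac' hf.stronglyMeasurable (by simp))]
  simp only [integral_dirac' _ _ hf.stronglyMeasurable, ENNReal.toReal_inv, ENNReal.toReal_natCast,
    smul_eq_mul]
  rw [div_eq_inv_mul]

/-- The bound `B` does not enter the conclusion: it ensures that the suprema are genuine, since a
real `⨆` of an unbounded family is `0`. -/
lemma abs_ipm_sub_ipm_le {E : Type*} [MeasurableSpace E] {F : Set (E → ℝ)} {μ ν μ' ν' : Measure E}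
    {B b : ℝ} (hb : 0 ≤ b) (h : ∀ f ∈ F, |∫ x, f x ∂μ - ∫ x, f x ∂ν| ≤ B)
    (h' : ∀ f ∈ F, |∫ x, f x ∂μ' - ∫ x, f x ∂ν'| ≤ B)
    (hd : ∀ f ∈ F, |(∫ x, f x ∂μ - ∫ x, f x ∂ν) - (∫ x, f x ∂μ' - ∫ x, f x ∂ν')| ≤ b) :
    |ipm F μ ν - ipm F μ' ν'| ≤ b := by
  have hB : BddAbove (Set.range fun f : F => |∫ x, f.1 x ∂μ - ∫ x, f.1 x ∂ν|) :=
    ⟨B, by rintro _ ⟨f, rfl⟩; exact h f.1 f.2⟩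
  have hB' : BddAbove (Set.range fun f : F => |∫ x, f.1 x ∂μ' - ∫ x, f.1 x ∂ν'|) :=
    ⟨B, by rintro _ ⟨f, rfl⟩; exact h' f.1 f.2⟩
  rw [abs_sub_le_iff, sub_le_iff_le_add, sub_le_iff_le_add]
  constructor
  · refine Real.iSup_le (fun f => ?_) (add_nonneg hb (Real.iSup_nonneg fun _ => abs_nonneg _))
    have h1 := le_ciSup hB' f
    have h2 := (abs_sub_abs_le_abs_sub _ _).trans (hd f.1 f.2)
    unfold ipm
    linarith
  · refine Real.iSup_le (fun f => ?_) (add_nonneg hb (Real.iSup_nonneg fun _ => abs_nonneg _))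
    have h1 := le_ciSup hB f
    have h2 := (abs_sub_abs_le_abs_sub _ _).trans ((abs_sub_comm _ _).trans_le (hd f.1 f.2))
    unfold ipm
    linarith

lemma continuous_network {d : ℕ} {width : ℕ → ℕ} {σ : ℕ → ℝ → ℝ}
    (hσ : ∀ i < d - 1, Continuous (σ i)) (p : Params d width) :
    Continuous (network d width σ p) := by
  have hid (k : ℕ) (hk : k ≤ d - 1) : Continuous fun x => hidden width σ p.1 x k := by
    induction k with
    | zero => exact continuous_pi fun j => by simp only [hidden]; fun_prop
    | succ k ih =>
      refine continuous_pi fun j => (hσ k hk).comp ?_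
      exact (continuous_apply j).comp
        ((continuous_const (y := p.1 k)).matrix_mulVec (ih (Nat.le_of_succ_le hk)))
  exact continuous_finsetSum _ fun j _ =>
    continuous_const.mul ((continuous_apply j).comp (hid _ le_rfl))

lemma integral_sub_mean_le {E : Type*} [MeasurableSpace E] {μ : Measure E}
    [IsProbabilityMeasure μ] {K : Set E} (hμ : ∀ᵐ x ∂μ, x ∈ K) {f g : E → ℝ} (hf : Integrable f μ)
    (hg : Integrable g μ) {n : ℕ} (hn : 1 ≤ n) {x : Fin n → E} (hx : ∀ k, x k ∈ K) {η u : ℝ}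
    (hfg : ∀ x ∈ K, |f x - g x| ≤ η) (hu : |∫ y, g y ∂μ - (∑ k, g (x k)) / n| ≤ u) :
    |∫ y, f y ∂μ - (∑ k, f (x k)) / n| ≤ u + 2 * η := by
  have h1 : |∫ y, f y ∂μ - ∫ y, g y ∂μ| ≤ η := by
    rw [← integral_sub hf hg]
    simpa using norm_integral_le_of_norm_le_const (μ := μ) (f := fun x => f x - g x) (C := η)
      (by filter_upwards [hμ] with x hx using by simpa using hfg x hx)
  have h2 : |(∑ k, f (x k)) / n - (∑ k, g (x k)) / n| ≤ η := by
    rw [← sub_div, ← Finset.sum_sub_distrib]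
    exact abs_sum_div_le hn fun k => hfg _ (hx k)
  rw [abs_le] at *
  constructor <;> linarith

lemma ae_sampleLaw_mem {E : Type*} [MeasurableSpace E] {n m : ℕ} {μ ν : Measure E}
    [IsProbabilityMeasure μ] [IsProbabilityMeasure ν] {K : Set E} (hμ : ∀ᵐ x ∂μ, x ∈ K)
    (hν : ∀ᵐ x ∂ν, x ∈ K) :
    ∀ᵐ s ∂sampleLaw n m μ ν, (∀ k, s.1 k ∈ K) ∧ ∀ k, s.2 k ∈ K := by
  have p1 : MeasurePreserving Prod.fst (sampleLaw n m μ ν) (Measure.pi fun _ : Fin n => μ) :=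
    measurePreserving_fst
  have p2 : MeasurePreserving Prod.snd (sampleLaw n m μ ν) (Measure.pi fun _ : Fin m => ν) :=
    measurePreserving_snd
  refine Filter.Eventually.and (ae_all_iff.2 fun k => ?_) (ae_all_iff.2 fun k => ?_)
  · exact ((measurePreserving_eval (fun _ => μ) k).comp p1).quasiMeasurePreserving.ae hμ
  · exact ((measurePreserving_eval (fun _ => ν) k).comp p2).quasiMeasurePreserving.ae hν

lemma sqrt_add_le_add_sqrt {x y : ℝ} (hx : 0 ≤ x) (hy : 0 ≤ y) : √(x + y) ≤ √x + √y := by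
  rw [Real.sqrt_le_left (by positivity)]
  nlinarith [Real.sq_sqrt hx, Real.sq_sqrt hy, Real.sqrt_nonneg x, Real.sqrt_nonneg y,
    mul_nonneg (Real.sqrt_nonneg x) (Real.sqrt_nonneg y)]

/-- Estimation of the network distance from samples, for a class whose layers can be peeled
off. -/
theorem PeelableClass.estimation {N : (w : ℕ) → (Fin w → ℝ) → ℝ}
    {d : ℕ} {width : ℕ → ℕ} {σ : ℕ → ℝ → ℝ} {L : ℕ → ℝ≥0} {M : ℕ → ℝ} {Γ a : ℝ}
    {𝒜 : (i : ℕ) → Set (Matrix (Fin (width (i + 1))) (Fin (width i)) ℝ)}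
    {𝒪 : Set (Fin (width (d - 1)) → ℝ)}
    (h : PeelableClass d width σ L M Γ a N 𝒜 𝒪) (hd : 1 ≤ d) (ha : 0 < a)
    {μ ν : Measure (EuclideanSpace ℝ (Fin (width 0)))}
    (hμ : μ ∈ boundedClass (width 0) Γ) (hν : ν ∈ boundedClass (width 0) Γ)
    {n m : ℕ} (hn : 1 ≤ n) (hm : 1 ≤ m) {δ : ℝ} (hδ : 0 < δ) (hδ1 : δ ≤ 1) :
    ENNReal.ofReal (1 - δ) ≤ sampleLaw n m μ ν
      {s | |ipm (networkClass d width σ (constrainedParams d width 𝒜 𝒪)) μ ν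
          - ipm (networkClass d width σ (constrainedParams d width 𝒜 𝒪))
            (empirical s.1) (empirical s.2)|
        ≤ Γ * (∏ i ∈ Finset.range d, M i) * (∏ i ∈ Finset.range (d - 1), (L i : ℝ))
          * (2 * √(2 * ((d - 1 : ℕ) * Real.log 2 + a)) + √(2 * Real.log (1 / δ)))
          * (1 / √n + 1 / √m)} := by
  obtain ⟨_, hμK⟩ := hμ
  obtain ⟨_, hνK⟩ := hν
  have hΓ : 0 ≤ Γ := by
    obtain ⟨x, hx⟩ := hμK.exists
    exact (norm_nonneg x).trans hx
  set F := networkClass d width σ (constrainedParams d width 𝒜 𝒪) with hF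
  set B := Γ * (∏ i ∈ Finset.range d, M i) * ∏ i ∈ Finset.range (d - 1), (L i : ℝ) with hB
  set T := (d - 1 : ℕ) * Real.log 2 + a with hT
  have hB0 : 0 ≤ B := mul_nonneg (mul_nonneg hΓ (Finset.prod_nonneg fun i hi =>
    h.bound_nonneg i (Finset.mem_range.1 hi))) (Finset.prod_nonneg fun i _ => (L i).2)
  have hn0 : (0 : ℝ) < n := by exact_mod_cast hn
  have hm0 : (0 : ℝ) < m := by exact_mod_cast hm
  have hfc : ∀ f ∈ F, Continuous f := by
    rintro _ ⟨p, -, rfl⟩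
    exact continuous_network (fun i hi => (h.lipschitz i hi).continuous) p
  have hfB : ∀ f ∈ F, ∀ x, ‖x‖ ≤ Γ → |f x| ≤ B := by
    rintro _ ⟨p, hp, rfl⟩ x hx
    exact h.abs_network_le hd hp hx
  have hfi (ρ : Measure (EuclideanSpace ℝ (Fin (width 0)))) [IsProbabilityMeasure ρ]
      (hρ : ∀ᵐ x ∂ρ, ‖x‖ ≤ Γ) (f) (hf : f ∈ F) : |∫ x, f x ∂ρ| ≤ B := by
    simpa using norm_integral_le_of_norm_le_const (μ := ρ) (f := f) (C := B)
      (by filter_upwards [hρ] with x hx using by simpa using hfB f hf x hx)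
  have hfe {l : ℕ} (hl : 1 ≤ l) (x : Fin l → EuclideanSpace ℝ (Fin (width 0)))
      (hx : ∀ k, ‖x k‖ ≤ Γ) (f) (hf : f ∈ F) : |(∑ k, f (x k)) / l| ≤ B :=
    abs_sum_div_le hl fun k => hfB f hf _ (hx k)
  have hae := ae_sampleLaw_mem (n := n) (m := m) (K := {x | ‖x‖ ≤ Γ}) hμK hνK
  have hred (s : (Fin n → EuclideanSpace ℝ (Fin (width 0)))
        × (Fin m → EuclideanSpace ℝ (Fin (width 0))))
      (hs : (∀ k, ‖s.1 k‖ ≤ Γ) ∧ ∀ k, ‖s.2 k‖ ≤ Γ) {u v : ℝ} (hu0 : 0 ≤ u) (hv0 : 0 ≤ v)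
      (hu : ∀ f ∈ F, |∫ x, f x ∂μ - (∑ k, f (s.1 k)) / n| ≤ u)
      (hv : ∀ f ∈ F, |∫ x, f x ∂ν - (∑ k, f (s.2 k)) / m| ≤ v) :
      |ipm F μ ν - ipm F (empirical s.1) (empirical s.2)| ≤ u + v := by
    refine abs_ipm_sub_ipm_le (B := 2 * B) (by positivity) (fun f hf => ?_) (fun f hf => ?_)
      fun f hf => ?_
    · linarith [abs_sub (∫ x, f x ∂μ) (∫ x, f x ∂ν), hfi μ hμK f hf, hfi ν hνK f hf]
    · rw [integral_empirical _ (hfc f hf).measurable, integral_empirical _ (hfc f hf).measurable]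
      linarith [abs_sub ((∑ k, f (s.1 k)) / n) ((∑ k, f (s.2 k)) / m),
        hfe hn s.1 hs.1 f hf, hfe hm s.2 hs.2 f hf]
    · rw [integral_empirical _ (hfc f hf).measurable, integral_empirical _ (hfc f hf).measurable]
      have h1 := hu f hf
      have h2 := hv f hf
      rw [abs_le] at h1 h2 ⊢
      constructor <;> linarith
  have : IsProbabilityMeasure (sampleLaw n m μ ν) := by unfold sampleLaw; infer_instance
  -- The optimal `t` divides by `B`. If `B = 0`, all means and sample means vanish almost surely and
  -- the error is `0`.
  rcases hB0.eq_or_lt with hB0' | hBpos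
  · rw [← hB0']
    refine le_trans (le_trans (ENNReal.ofReal_le_ofReal (by linarith : 1 - δ ≤ 1)) ?_)
      (measure_mono_ae (s := Set.univ) ?_)
    · simp
    · filter_upwards [hae] with s hs _
      have := hred s hs le_rfl le_rfl (fun f hf => ?_) fun f hf => ?_
      · rw [add_zero] at this
        exact this.trans_eq (by simp)
      · have h1 := hfi μ hμK f hf
        have h2 := hfe hn s.1 hs.1 f hf
        rw [← hB0', abs_nonpos_iff] at h1 h2
        simp [h1, h2]
      · have h1 := hfi ν hνK f hf
        have h2 := hfe hm s.2 hs.2 f hf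
        rw [← hB0', abs_nonpos_iff] at h1 h2
        simp [h1, h2]
  obtain ⟨F₀, hF₀, hc, hdense⟩ := exists_countable_uniformly_dense
    (isCompact_closedBall (0 : EuclideanSpace ℝ (Fin (width 0))) Γ) hfc
  have : Countable F₀ := hc.to_subtype
  -- Sending points outside the ball to `0` makes the functions bounded everywhere, as McDiarmid
  -- requires; almost surely nothing changes.
  let cl : EuclideanSpace ℝ (Fin (width 0)) → EuclideanSpace ℝ (Fin (width 0)) :=
    fun x => if ‖x‖ ≤ Γ then x else 0
  have hclm : Measurable cl :=
    Measurable.ite (measurableSet_le measurable_norm measurable_const) measurable_id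
      measurable_const
  have hcl (x) : ‖cl x‖ ≤ Γ := by
    by_cases hx : ‖x‖ ≤ Γ <;> simp [cl, hx, hΓ]
  have hcl' {x} (hx : ‖x‖ ≤ Γ) : cl x = x := if_pos hx
  let g : F₀ → EuclideanSpace ℝ (Fin (width 0)) → ℝ := fun f x => f.1 (cl x)
  have hgm (f : F₀) : Measurable (g f) := (hfc _ (hF₀ f.2)).measurable.comp hclm
  have hgB (f : F₀) (x) : |g f x| ≤ B := hfB _ (hF₀ f.2) _ (hcl x)
  have hrad {l : ℕ} (hl : 1 ≤ l) (x : Fin l → EuclideanSpace ℝ (Fin (width 0))) :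
      ∑ ε : Fin l → Bool, ⨆ f, ENNReal.ofReal |∑ k, sgn (ε k) * g f (x k)|
        ≤ 2 ^ l * ENNReal.ofReal (B * √l * √(2 * T)) := by
    refine le_trans (Finset.sum_le_sum fun ε _ => iSup_le fun f => ?_)
      (h.sum_signs_network_le hd ha hl (fun k => cl (x k)) (fun k => hcl _) hB hBpos)
    obtain ⟨p, hp, hpf⟩ := hF₀ f.2
    have := le_iSup (fun p : constrainedParams d width 𝒜 𝒪 =>
      ENNReal.ofReal |∑ k, sgn (ε k) * network d width σ p.1 (cl (x k))|) ⟨p, hp⟩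
    simpa only [hpf] using this
  have hdev {l : ℕ} (hl : 1 ≤ l) (ρ : Measure (EuclideanSpace ℝ (Fin (width 0))))
      [IsProbabilityMeasure ρ] (hρ : ∀ᵐ x ∂ρ, ‖x‖ ≤ Γ)
      (x : Fin l → EuclideanSpace ℝ (Fin (width 0))) (hx : ∀ k, ‖x k‖ ≤ Γ) (f) (hf : f ∈ F) :
      |∫ y, f y ∂ρ - (∑ k, f (x k)) / l| ≤ uniformDeviation g ρ x := by
    refine le_of_forall_pos_le_add fun η hη => ?_
    obtain ⟨f', hf', hff'⟩ := hdense f hf (η / 2) (half_pos hη)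
    have := integral_sub_mean_le (μ := ρ) (K := {x | ‖x‖ ≤ Γ}) hρ (f := f) (g := g ⟨f', hf'⟩)
      (Integrable.of_bound (hfc f hf).aestronglyMeasurable B
        (by filter_upwards [hρ] with x hx using by simpa using hfB f hf x hx))
      (integrable_of_abs_le (hgm _) (hgB _)) hl hx
      (fun x hx => by
        simp only [g, hcl' hx]
        exact hff' x (by simpa using hx))
      (le_uniformDeviation hgB ρ hl x ⟨f', hf'⟩)
    linarith
  refine (sampleLaw_uniformDeviation_ge hgm hBpos hgB μ ν hn hm (by positivity) (by positivity)
    (hrad hn) (hrad hm) hδ hδ1).trans (measure_mono_ae ?_)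
  filter_upwards [hae] with s hs hle
  refine (hred s hs (uniformDeviation_nonneg g μ _) (uniformDeviation_nonneg g ν _)
    (hdev hn μ hμK s.1 hs.1) (hdev hm ν hνK s.2 hs.2)).trans (le_trans hle ?_)
  have hlog : 0 ≤ Real.log (1 / δ) := Real.log_nonneg (by rwa [one_le_div hδ])
  have r1 (l : ℝ) (hl : 0 < l) : 2 * (B * √l * √(2 * T)) / l = B * (2 * √(2 * T)) * (1 / √l) := by
    have h1 : √l ≠ 0 := (Real.sqrt_pos.2 hl).ne'
    have h2 : l = √l * √l := (Real.mul_self_sqrt hl.le).symm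
    rw [div_eq_iff hl.ne']
    nth_rw 3 [h2]
    field_simp
  -- Subadditivity of the square root separates the two sample sizes.
  have r2 : √(2 * (B ^ 2 / n + B ^ 2 / m) * Real.log (1 / δ))
      ≤ B * √(2 * Real.log (1 / δ)) * (1 / √n + 1 / √m) := by
    have e : 2 * (B ^ 2 / n + B ^ 2 / m) * Real.log (1 / δ)
        = B ^ 2 * (2 * Real.log (1 / δ)) * (1 / n + 1 / m) := by ring
    rw [e, Real.sqrt_mul (by positivity), Real.sqrt_mul (by positivity), Real.sqrt_sq hB0]
    refine mul_le_mul_of_nonneg_left ((sqrt_add_le_add_sqrt (by positivity)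
      (by positivity)).trans_eq ?_) (by positivity)
    simp
  rw [r1 n hn0, r1 m hm0]
  linarith

/-! ### The Frobenius norm constraint. -/

section Frobenius

lemma l2Norm_nonneg {r : ℕ} (w : Fin r → ℝ) : 0 ≤ l2Norm w := Real.sqrt_nonneg _

lemma sq_l2Norm {r : ℕ} (w : Fin r → ℝ) : l2Norm w ^ 2 = ∑ j, w j ^ 2 :=
  Real.sq_sqrt (Finset.sum_nonneg fun _ _ => sq_nonneg _)

lemma l2Norm_eq_norm {r : ℕ} (x : EuclideanSpace ℝ (Fin r)) : l2Norm (fun j => x j) = ‖x‖ := by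
  simp [l2Norm, EuclideanSpace.norm_eq]

lemma abs_dotProduct_le_l2Norm {r : ℕ} (w u : Fin r → ℝ) : |w ⬝ᵥ u| ≤ l2Norm w * l2Norm u := by
  refine abs_le_of_sq_le_sq ?_ (mul_nonneg (l2Norm_nonneg w) (l2Norm_nonneg u))
  rw [mul_pow, sq_l2Norm, sq_l2Norm]
  exact Finset.sum_mul_sq_le_sq_mul_sq _ _ _

lemma exists_unit_direction {r : ℕ} (w : Fin r → ℝ) :
    ∃ u : Fin r → ℝ, l2Norm u ≤ 1 ∧ w = l2Norm w • u := by
  rcases (l2Norm_nonneg w).eq_or_lt with h | h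
  · refine ⟨0, by simp [l2Norm], ?_⟩
    have h2 := sq_l2Norm w
    rw [← h, zero_pow two_ne_zero, eq_comm,
      Finset.sum_eq_zero_iff_of_nonneg fun _ _ => sq_nonneg _] at h2
    rw [smul_zero]
    exact funext fun j => pow_eq_zero_iff two_ne_zero |>.1 (h2 j (Finset.mem_univ j))
  · refine ⟨(l2Norm w)⁻¹ • w, ?_, (smul_inv_smul₀ h.ne' w).symm⟩
    refine le_of_sq_le_sq ?_ zero_le_one
    rw [sq_l2Norm]
    simp only [Pi.smul_apply, smul_eq_mul, mul_pow, ← Finset.mul_sum, ← sq_l2Norm]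
    rw [← mul_pow, inv_mul_cancel₀ h.ne']

/-- Each row is its length times a vector of norm at most one, and homogeneity pulls the length out
of `σ`. The squared norm becomes a sum of `T j ^ 2` with weights of total at most `M²`, hence at
most `M²` times the largest; so `κ = M` and the neuron is the direction of one row. -/
lemma dominatedByNeuron_frobNorm {σ : ℝ → ℝ} (h0 : σ 0 = 0)
    (hσ : ∀ α : ℝ, 0 < α → ∀ x, σ (α * x) = α * σ x) {M : ℝ} (hM : 0 ≤ M) {r c : ℕ} :
    DominatedByNeuron (fun _ => l2Norm) σ M
      {W : Matrix (Fin r) (Fin c) ℝ | frobNorm W ≤ M} := by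
  refine ⟨M, hM, fun W hW n v e => ?_⟩
  have hneuron (w : Fin c → ℝ) (hw : l2Norm w ≤ 1) (u : Fin c → ℝ) :
      M * |w ⬝ᵥ u| ≤ M * l2Norm u :=
    mul_le_mul_of_nonneg_left ((abs_dotProduct_le_l2Norm w u).trans
      (mul_le_of_le_one_left (l2Norm_nonneg u) hw)) hM
  choose u hu1 hu using fun j => exists_unit_direction (W j)
  -- Zero rows need homogeneity at `α = 0` too, which is `σ 0 = 0`.
  have hσ' (α : ℝ) (hα : 0 ≤ α) (x : ℝ) : σ (α * x) = α * σ x := by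
    rcases hα.eq_or_lt with rfl | hα
    · simp [h0]
    · exact hσ α hα x
  let T : Fin r → ℝ := fun j => ∑ i, e i * σ (u j ⬝ᵥ v i)
  have hrow (j : Fin r) : (∑ i, e i • fun j => σ (W.mulVec (v i) j)) j = l2Norm (W j) * T j := by
    simp only [T, Finset.sum_apply, Pi.smul_apply, smul_eq_mul, Finset.mul_sum]
    refine Finset.sum_congr rfl fun i _ => ?_
    have : W.mulVec (v i) j = l2Norm (W j) * (u j ⬝ᵥ v i) := by
      conv_lhs => rw [Matrix.mulVec, hu j]
      rw [smul_dotProduct, smul_eq_mul]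
    rw [this, hσ' _ (l2Norm_nonneg _)]
    ring
  rcases isEmpty_or_nonempty (Fin r) with _ | _
  · exact ⟨0, hneuron 0 (by simp [l2Norm]), by simp [l2Norm]; positivity⟩
  obtain ⟨k, hk⟩ := Finite.exists_max fun j => |T j|
  refine ⟨u k, hneuron _ (hu1 k), le_of_sq_le_sq ?_ (by positivity)⟩
  change _ ≤ (M * |T k|) ^ 2
  rw [sq_l2Norm]
  have hW2 : ∑ j, l2Norm (W j) ^ 2 ≤ M ^ 2 := by
    simp only [sq_l2Norm]
    rw [← Real.sqrt_le_left hM]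
    exact hW
  calc _ = ∑ j, l2Norm (W j) ^ 2 * T j ^ 2 :=
        Finset.sum_congr rfl fun j _ => by rw [hrow, mul_pow]
    _ ≤ ∑ j, l2Norm (W j) ^ 2 * |T k| ^ 2 := Finset.sum_le_sum fun j _ => by
        rw [← sq_abs (T j)]
        exact mul_le_mul_of_nonneg_left (pow_le_pow_left₀ (abs_nonneg _) (hk j) 2) (sq_nonneg _)
    _ ≤ M ^ 2 * |T k| ^ 2 := by
        rw [← Finset.sum_mul]
        exact mul_le_mul_of_nonneg_right hW2 (sq_nonneg _)
    _ = _ := by ring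

lemma two_pow_eq_ofReal (n : ℕ) : (2 : ℝ≥0∞) ^ n = ENNReal.ofReal (2 ^ n) := by
  rw [ENNReal.ofReal_pow two_pos.le, ENNReal.ofReal_ofNat]

lemma sum_signs_expE_l2Norm_le {w : ℕ} {Γ t : ℝ} (ht : 0 ≤ t) {n : ℕ}
    (x : Fin n → EuclideanSpace ℝ (Fin w)) (hx : ∀ i, ‖x i‖ ≤ Γ) :
    ∑ ε : Fin n → Bool, expE (t * l2Norm (∑ i, sgn (ε i) • fun j => x i j))
      ≤ 2 ^ n * expE (Real.log 2 + t ^ 2 * (n * Γ ^ 2) / 2) := by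
  have e (ε : Fin n → Bool) : t * l2Norm (∑ i, sgn (ε i) • fun j => x i j)
      = ‖∑ i, sgn (ε i) • (t • x i)‖ := by
    have h1 : (∑ i, sgn (ε i) • fun j => x i j) = fun j => (∑ i, sgn (ε i) • x i) j := by
      ext j
      simp
    rw [h1, l2Norm_eq_norm]
    simp only [smul_comm _ t, ← Finset.smul_sum]
    rw [norm_smul, Real.norm_of_nonneg ht]
  simp only [e, expE]
  rw [← ENNReal.ofReal_sum_of_nonneg fun _ _ => (Real.exp_pos _).le]
  refine (ENNReal.ofReal_le_ofReal (sum_signs_exp_norm_le fun i => t • x i)).trans ?_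
  rw [two_pow_eq_ofReal, ← ENNReal.ofReal_mul (by positivity), Real.exp_add, Real.exp_log two_pos]
  refine ENNReal.ofReal_le_ofReal ?_
  gcongr
  calc ∑ i, ‖t • x i‖ ^ 2 ≤ ∑ _i : Fin n, t ^ 2 * Γ ^ 2 := Finset.sum_le_sum fun i _ => by
        rw [norm_smul, mul_pow, Real.norm_eq_abs, sq_abs]
        exact mul_le_mul_of_nonneg_left (pow_le_pow_left₀ (norm_nonneg _) (hx i) 2) (sq_nonneg _)
    _ = _ := by simp; ring

lemma peelableClass_frobNorm {d : ℕ} (hd : 1 ≤ d) (width : ℕ → ℕ) {σ : ℕ → ℝ → ℝ}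
    {L : ℕ → ℝ≥0} (hσL : ∀ i < d - 1, LipschitzWith (L i) (σ i))
    (hσ : ∀ i < d - 1, ∀ α : ℝ, 0 < α → ∀ x : ℝ, σ i (α * x) = α * σ i x) {M : ℕ → ℝ}
    (hM : ∀ i < d, 0 ≤ M i) (Γ : ℝ) :
    PeelableClass d width σ L M Γ (Real.log 2) (fun _ => l2Norm) (fun i => {W | frobNorm W ≤ M i})
      {w | l2Norm w ≤ M (d - 1)} := by
  have h0 : ∀ i < d - 1, σ i 0 = 0 := fun i hi => by
    have := hσ i hi 2 two_pos 0
    rw [mul_zero] at this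
    linarith
  exact
  { layer := fun i hi => dominatedByNeuron_frobNorm (h0 i hi) (hσ i hi) (hM i (by omega))
    lipschitz := hσL
    map_zero := h0
    bound_nonneg := hM
    output := fun w hw u => (abs_dotProduct_le_l2Norm w u).trans
      (mul_le_mul_of_nonneg_right hw (l2Norm_nonneg u))
    input := fun x hx => (l2Norm_eq_norm x).trans_le hx
    moment := fun t ht n x hx => sum_signs_expE_l2Norm_le ht x hx }

end Frobenius

/-! ### The maximal row-sum constraint. -/

section OneInfty

lemma abs_dotProduct_le_l1Norm {r : ℕ} (w u : Fin r → ℝ) : |w ⬝ᵥ u| ≤ l1Norm w * ‖u‖ := by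
  refine (Finset.abs_sum_le_sum_abs _ _).trans ?_
  rw [l1Norm, Finset.sum_mul]
  refine Finset.sum_le_sum fun j _ => ?_
  rw [abs_mul]
  exact mul_le_mul_of_nonneg_left (norm_le_pi_norm u j) (abs_nonneg _)

/-- The sup norm of the output is attained at one row, which serves as the neuron with `κ = 1`;
homogeneity of `σ` plays no role. -/
lemma dominatedByNeuron_oneInftyNorm (σ : ℝ → ℝ) {M : ℝ} (hM : 0 ≤ M) {r c : ℕ} :
    DominatedByNeuron (fun _ v => ‖v‖) σ M
      {W : Matrix (Fin r) (Fin c) ℝ | oneInftyNorm W ≤ M} := by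
  refine ⟨1, zero_le_one, fun W hW n v e => ?_⟩
  rcases isEmpty_or_nonempty (Fin r) with _ | _
  · refine ⟨0, fun u => by simp; positivity, ?_⟩
    rw [Subsingleton.elim (∑ i, e i • fun j => σ (W.mulVec (v i) j)) 0]
    simp
  obtain ⟨k, hk⟩ := Finite.exists_max fun j => |∑ i, e i * σ (W j ⬝ᵥ v i)|
  refine ⟨W k, fun u => ?_, ?_⟩
  · rw [one_mul]
    have hrow : l1Norm (W k) ≤ M :=
      (le_ciSup (Set.finite_range fun i => ∑ j, |W i j|).bddAbove k).trans hW
    exact (abs_dotProduct_le_l1Norm _ u).trans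
      (mul_le_mul_of_nonneg_right hrow (norm_nonneg u))
  · rw [one_mul, pi_norm_le_iff_of_nonneg (abs_nonneg _)]
    intro j
    simpa [Matrix.mulVec] using hk j

/-- The exponential of a maximum is at most the sum over the `w` coordinates, each a scalar
Rademacher sum; the factor `2w` becomes `log 2 + log w`. -/
lemma sum_signs_expE_pi_norm_le {w : ℕ} {Γ t : ℝ} (ht : 0 ≤ t) {n : ℕ}
    (x : Fin n → EuclideanSpace ℝ (Fin w)) (hx : ∀ i, ‖x i‖ ≤ Γ) :
    ∑ ε : Fin n → Bool, expE (t * ‖∑ i, sgn (ε i) • fun j => x i j‖)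
      ≤ 2 ^ n * expE (Real.log 2 + Real.log w + t ^ 2 * (n * Γ ^ 2) / 2) := by
  simp only [expE]
  rw [← ENNReal.ofReal_sum_of_nonneg fun _ _ => (Real.exp_pos _).le, two_pow_eq_ofReal,
    ← ENNReal.ofReal_mul (by positivity), Real.exp_add, Real.exp_add, Real.exp_log two_pos]
  refine ENNReal.ofReal_le_ofReal ?_
  have hV : 0 ≤ t ^ 2 * (n * Γ ^ 2) / 2 := by positivity
  -- For `w = 0` the convention `Real.log 0 = 0` keeps the bound true.
  rcases Nat.eq_zero_or_pos w with rfl | hw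
  · have e (ε : Fin n → Bool) : ‖∑ i, sgn (ε i) • fun j => x i j‖ = 0 := by
      rw [Subsingleton.elim (∑ i, sgn (ε i) • fun j => x i j) 0, norm_zero]
    simp only [e, mul_zero, Real.exp_zero, Finset.sum_const, Finset.card_univ, Fintype.card_fun,
      Fintype.card_bool, Fintype.card_fin, nsmul_eq_mul, mul_one, CharP.cast_eq_zero,
      Real.log_zero, Nat.cast_pow, Nat.cast_ofNat]
    refine le_mul_of_one_le_right (by positivity) ?_
    linarith [Real.one_le_exp hV]
  · have hw0 : (0 : ℝ) < w := by exact_mod_cast hw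
    have : Nonempty (Fin w) := ⟨⟨0, hw⟩⟩
    rw [Real.exp_log hw0]
    have hε (ε : Fin n → Bool) : Real.exp (t * ‖∑ i, sgn (ε i) • fun j => x i j‖)
        ≤ ∑ j, Real.exp |∑ i, sgn (ε i) * (t * x i j)| := by
      obtain ⟨k, hk⟩ := Finite.exists_max fun j => |∑ i, sgn (ε i) * x i j|
      have hnorm : ‖∑ i, sgn (ε i) • fun j => x i j‖ ≤ |∑ i, sgn (ε i) * x i k| := by
        rw [pi_norm_le_iff_of_nonneg (abs_nonneg _)]
        intro j
        simpa using hk j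
      have e : t * |∑ i, sgn (ε i) * x i k| = |∑ i, sgn (ε i) * (t * x i k)| := by
        nth_rw 1 [← abs_of_nonneg ht]
        rw [← abs_mul, Finset.mul_sum]
        exact congrArg abs (Finset.sum_congr rfl fun i _ => by ring)
      refine le_trans (Real.exp_le_exp.2 ((mul_le_mul_of_nonneg_left hnorm ht).trans_eq e)) ?_
      exact Finset.single_le_sum (f := fun j => Real.exp |∑ i, sgn (ε i) * (t * x i j)|)
        (fun j _ => (Real.exp_pos _).le) (Finset.mem_univ k)
    have hcoord (j : Fin w) : ∑ ε : Fin n → Bool, Real.exp |∑ i, sgn (ε i) * (t * x i j)|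
        ≤ 2 ^ n * (2 * Real.exp (t ^ 2 * (n * Γ ^ 2) / 2)) := by
      refine (sum_signs_exp_abs_le fun i => t * x i j).trans ?_
      gcongr
      calc ∑ i, (t * x i j) ^ 2 ≤ ∑ _i : Fin n, t ^ 2 * Γ ^ 2 := Finset.sum_le_sum fun i _ => by
            rw [mul_pow, ← sq_abs (x i j)]
            exact mul_le_mul_of_nonneg_left (pow_le_pow_left₀ (abs_nonneg _)
              ((PiLp.norm_apply_le (x i) j).trans (hx i)) 2) (sq_nonneg _)
        _ = _ := by simp; ring
    calc _ ≤ ∑ ε : Fin n → Bool, ∑ j, Real.exp |∑ i, sgn (ε i) * (t * x i j)| :=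
          Finset.sum_le_sum fun ε _ => hε ε
      _ = ∑ j, ∑ ε : Fin n → Bool, Real.exp |∑ i, sgn (ε i) * (t * x i j)| := Finset.sum_comm
      _ ≤ ∑ _j : Fin w, 2 ^ n * (2 * Real.exp (t ^ 2 * (n * Γ ^ 2) / 2)) :=
          Finset.sum_le_sum fun j _ => hcoord j
      _ = _ := by simp; ring

lemma peelableClass_oneInftyNorm {d : ℕ} (hd : 1 ≤ d) (width : ℕ → ℕ) {σ : ℕ → ℝ → ℝ}
    {L : ℕ → ℝ≥0} (hσL : ∀ i < d - 1, LipschitzWith (L i) (σ i)) (h0 : ∀ i < d - 1, σ i 0 = 0)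
    {M : ℕ → ℝ} (hM : ∀ i < d, 0 ≤ M i) (Γ : ℝ) :
    PeelableClass d width σ L M Γ (Real.log 2 + Real.log (width 0)) (fun _ v => ‖v‖)
      (fun i => {W | oneInftyNorm W ≤ M i}) {w | l1Norm w ≤ M (d - 1)} where
  layer i hi := dominatedByNeuron_oneInftyNorm (σ i) (hM i (by omega))
  lipschitz := hσL
  map_zero := h0
  bound_nonneg := hM
  output w hw u := (abs_dotProduct_le_l1Norm w u).trans
    (mul_le_mul_of_nonneg_right hw (norm_nonneg u))
  input x hx := (pi_norm_le_iff_of_nonneg ((norm_nonneg x).trans hx)).2 fun j =>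
    (PiLp.norm_apply_le x j).trans hx
  moment t ht n x hx := sum_signs_expE_pi_norm_le ht x hx

end OneInfty

end NeuralNetDistance


/-! ### The two bounds with their constants. -/

theorem theorem4 (d : ℕ) (hd : 1 ≤ d) (width : ℕ → ℕ) (σ : ℕ → ℝ → ℝ) (L : ℕ → ℝ≥0)
    (hσ : ∀ i < d - 1, NeuralNetDistance.IsActivation (σ i) (L i))
    (Γ : ℝ) (μ ν : Measure (EuclideanSpace ℝ (Fin (width 0))))
    (hμ : μ ∈ NeuralNetDistance.boundedClass (width 0) Γ)
    (hν : ν ∈ NeuralNetDistance.boundedClass (width 0) Γ)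
    (M : ℕ → ℝ) (hM : ∀ i < d, 0 ≤ M i)
    (n m : ℕ) (hn : 1 ≤ n) (hm : 1 ≤ m) (δ : ℝ) (hδ : 0 < δ) (hδ1 : δ ≤ 1) :
    ((∀ i < d - 1, ∀ α : ℝ, 0 < α → ∀ x : ℝ, σ i (α * x) = α * σ i x) →
      ENNReal.ofReal (1 - δ) ≤ NeuralNetDistance.sampleLaw n m μ ν
        {s | |NeuralNetDistance.ipm (NeuralNetDistance.networkClass d width σ
                (NeuralNetDistance.paramsF d width M)) μ ν
              - NeuralNetDistance.ipm (NeuralNetDistance.networkClass d width σ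
                (NeuralNetDistance.paramsF d width M))
                (NeuralNetDistance.empirical s.1) (NeuralNetDistance.empirical s.2)|
            ≤ Real.sqrt 2 * Γ * (∏ i ∈ Finset.range d, M i)
              * (∏ i ∈ Finset.range (d - 1), (L i : ℝ))
              * (2 * Real.sqrt (d * Real.log 2) + Real.sqrt (Real.log (1 / δ)) + Real.sqrt 2)
              * (1 / Real.sqrt n + 1 / Real.sqrt m)}) ∧
    ((∀ i < d - 1, σ i 0 = 0) →
      ENNReal.ofReal (1 - δ) ≤ NeuralNetDistance.sampleLaw n m μ ν
        {s | |NeuralNetDistance.ipm (NeuralNetDistance.networkClass d width σ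
                (NeuralNetDistance.paramsOneInfty d width M)) μ ν
              - NeuralNetDistance.ipm (NeuralNetDistance.networkClass d width σ
                (NeuralNetDistance.paramsOneInfty d width M))
                (NeuralNetDistance.empirical s.1) (NeuralNetDistance.empirical s.2)|
            ≤ Γ * (∏ i ∈ Finset.range d, M i)
              * (∏ i ∈ Finset.range (d - 1), (L i : ℝ))
              * (4 * Real.sqrt (d + 1 + Real.log (width 0)) + Real.sqrt (2 * Real.log (1 / δ)))
              * (1 / Real.sqrt n + 1 / Real.sqrt m)}) := by
  have hL := fun i hi => (hσ i hi).lipschitz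
  have hlog : 0 ≤ Real.log (1 / δ) := Real.log_nonneg (by rwa [one_le_div hδ])
  have hΓ : 0 ≤ Γ := by
    have := hμ.1
    obtain ⟨x, hx⟩ := hμ.2.exists
    exact (norm_nonneg x).trans hx
  have hB : 0 ≤ Γ * (∏ i ∈ Finset.range d, M i) * ∏ i ∈ Finset.range (d - 1), (L i : ℝ) :=
    mul_nonneg (mul_nonneg hΓ (Finset.prod_nonneg fun i hi => hM i (Finset.mem_range.1 hi)))
      (Finset.prod_nonneg fun i _ => (L i).2)
  have hd1 : ((d - 1 : ℕ) : ℝ) = d - 1 := by push_cast [hd]; ring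
  have hd0 : (1 : ℝ) ≤ d := by exact_mod_cast hd
  have hlog2 : 0 < Real.log 2 := Real.log_pos one_lt_two
  constructor
  · intro hhom
    refine ((NeuralNetDistance.peelableClass_frobNorm hd width hL hhom hM Γ).estimation hd hlog2
      hμ hν hn hm hδ hδ1).trans (measure_mono fun s hs => ?_)
    refine Set.mem_ofPred.2 (le_trans (Set.mem_ofPred.1 hs) ?_)
    -- With `a = log 2` the layers contribute `d log 2` in total; the final `√2` in the stated bound
    -- is slack.
    have e1 : Real.sqrt (2 * ((d - 1 : ℕ) * Real.log 2 + Real.log 2))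
        = Real.sqrt 2 * Real.sqrt (d * Real.log 2) := by
      rw [← Real.sqrt_mul two_pos.le, hd1]
      ring_nf
    rw [e1, Real.sqrt_mul two_pos.le, mul_assoc (Real.sqrt 2), mul_assoc (Real.sqrt 2),
      mul_comm (Real.sqrt 2) (_ * _), mul_assoc _ (Real.sqrt 2)]
    refine mul_le_mul_of_nonneg_right (mul_le_mul_of_nonneg_left ?_ hB) (by positivity)
    nlinarith [Real.sq_sqrt (two_pos (α := ℝ)).le]
  · intro h0
    have hw : 0 ≤ Real.log (width 0) := Real.log_natCast_nonneg _
    refine ((NeuralNetDistance.peelableClass_oneInftyNorm hd width hL h0 hM Γ).estimation hd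
      (by positivity) hμ hν hn hm hδ hδ1).trans (measure_mono fun s hs => ?_)
    refine Set.mem_ofPred.2 (le_trans (Set.mem_ofPred.1 hs) ?_)
    refine mul_le_mul_of_nonneg_right (mul_le_mul_of_nonneg_left ?_ hB) (by positivity)
    have e : (4 : ℝ) * Real.sqrt (d + 1 + Real.log (width 0))
        = 2 * Real.sqrt (4 * (d + 1 + Real.log (width 0))) := by
      rw [Real.sqrt_mul (by norm_num), show (4 : ℝ) = 2 ^ 2 by norm_num,
        Real.sqrt_sq two_pos.le]
      ring
    rw [e]
    have hlog1 : Real.log 2 ≤ 1 := by linarith [Real.log_two_lt_d9]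
    -- The left side is `2 (d log 2 + log h)`, so `log 2 ≤ 1` suffices, with room to spare.
    have harg : 2 * ((d - 1 : ℕ) * Real.log 2 + (Real.log 2 + Real.log (width 0)))
        ≤ 4 * (d + 1 + Real.log (width 0)) := by
      rw [hd1]
      nlinarith
    linarith [Real.sqrt_le_sqrt harg]
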